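/- Let $b_0:(0,1)\to\mathbb{R}$ and $b_1:(0,1)\to\mathbb{C}$ satisfy $b_0<0$ a.e. on $(0,1)$, $w:=-1/b_0\in L^1(0,1)$ and $b_1/b_0\in L^1((0,1),\mathbb{C})$, and let $\nu_0,\nu_1$ be Borel probability measures on the open interval $(0,1)$. In the Hilbert space $L^2_w((0,1),\mathbb{C})$ let $L$ be the operator $Ly=b_0y''+b_1y'$ whose domain consists of all $y\in L^2_w$ with $y,y'\in AC[0,1]$, $b_0y''+b_1y'\in L^2_w$, $y(0)=\int_0^1 y\,d\nu_0$ and $y(1)=\int_0^1 y\,d\nu_1$. For $\lambda\in\mathbb{C}$ let $y_1(\cdot,\lambda),y_2(\cdot,\lambda)$ be the solutions ($y,y'\in AC[0,1]$, equation a.e.) of $b_0y''+b_1y'=\lambda y$ with $y_1(0,\lambda)=y_2'(0,\lambda)=1$ and $y_1'(0,\lambda)=y_2(0,\lambda)=0$, and put $$\Delta(\lambda)=\det\begin{pmatrix}\int_0^1y_1(x,\lambda)\,d\nu_0(x)-1 & \int_0^1y_2(x,\lambda)\,d\nu_0(x)\\ \int_0^1y_1(x,\lambda)\,d\nu_1(x)-y_1(1,\lambda)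 & \int_0^1y_2(x,\lambda)\,d\nu_1(x)-y_2(1,\lambda)\end{pmatrix}.$$ Then $\Delta$ is an entire function, and for every eigenvalue $\lambda_0$ of $L$ the algebraic multiplicity of $\lambda_0$, that is, the dimension of the generalized eigenspace $\bigcup_{n\ge1}\ker\big((L-\lambda_0I)^n\big)$, equals the order of $\lambda_0$ as a zero of $\Delta$ (an equality in $\{1,2,\dots\}\cup\{\infty\}$, where the order is $\infty$ if $\Delta$ vanishes identically). -/

import Mathlib

open MeasureTheory Set Topology
open scoped ENNReal

noncomputable section

namespace Diffusion

/-! ### Unbounded operators: eigenvalues and algebraic multiplicity -/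

section Operators

variable {E : Type*} [AddCommGroup E] [Module ℂ E]

/-- The operator `T - z I`, with the same domain as `T`. -/
def shift (T : E →ₗ.[ℂ] E) (z : ℂ) : E →ₗ.[ℂ] E :=
  (-(z • (LinearMap.id : E →ₗ[ℂ] E))) +ᵥ T

/-- `ker (T ^ n)` for an unbounded operator `T`. The powers have their natural domains:
`x ∈ dom (T ^ (n + 1))` means `x ∈ dom T` and `T x ∈ dom (T ^ n)`. -/
def kerPow (T : E →ₗ.[ℂ] E) : ℕ → Submodule ℂ E
  | 0 => ⊥
  | n + 1 => ((kerPow T n).comap T.toFun).map T.domain.subtype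

/-- `z` is an eigenvalue of `T`. -/
def IsEigenvalue (T : E →ₗ.[ℂ] E) (z : ℂ) : Prop :=
  ∃ x : T.domain, (x : E) ≠ 0 ∧ T x = z • (x : E)

/-- The generalized eigenspace, the union of the increasing sequence `ker ((T - z I) ^ n)`. -/
def generalizedEigenspace (T : E →ₗ.[ℂ] E) (z : ℂ) : Submodule ℂ E :=
  ⨆ n : ℕ, kerPow (shift T z) n

/-- The algebraic multiplicity, the dimension of the generalized eigenspace. -/
def algebraicMultiplicity (T : E →ₗ.[ℂ] E) (z : ℂ) : ℕ∞ :=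
  Cardinal.toENat (Module.rank ℂ (generalizedEigenspace T z))

end Operators

/-! ### The differential expression -/

/-- The derivative of a function on `[0,1]`, one-sided at the end points. -/
def der (y : ℝ → ℂ) : ℝ → ℂ := derivWithin y (Icc 0 1)

/-- `y` is differentiable on `[0,1]` and `y, y' ∈ AC[0,1]`. -/
structure IsAC2 (y : ℝ → ℂ) : Prop where
  differentiableOn : DifferentiableOn ℝ y (Icc 0 1)
  ac : AbsolutelyContinuousOnInterval y 0 1
  ac_der : AbsolutelyContinuousOnInterval (der y) 0 1

/-- The differential expression `l y = b₀ y'' + b₁ y'`. -/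
def diffExpr (b₀ : ℝ → ℝ) (b₁ : ℝ → ℂ) (y : ℝ → ℂ) (x : ℝ) : ℂ :=
  (b₀ x : ℂ) * der (der y) x + b₁ x * der y x

/-- The measure `w(x) dx` on `(0,1)` with `w = -1 / b₀`. -/
def weightMeasure (b₀ : ℝ → ℝ) : Measure ℝ :=
  (volume.restrict (Ioo 0 1)).withDensity fun x => ENNReal.ofReal (-1 / b₀ x)

/-- The Hilbert space `L²_w((0,1), ℂ)`. -/
abbrev WeightedL2 (b₀ : ℝ → ℝ) : Type := Lp ℂ 2 (weightMeasure b₀)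

variable (b₀ : ℝ → ℝ) (b₁ : ℝ → ℂ) (ν₀ ν₁ : Measure (Ioo (0 : ℝ) 1))

/-- The pair `(f, g)` in `L²_w` satisfies `f ∈ dom L` and `g = L f`: here `y` is the
representative of `f` with `y, y' ∈ AC[0,1]`, and `l y ∈ L²_w` has class `g`. -/
structure IsGraphPair (f g : WeightedL2 b₀) (y : ℝ → ℂ) : Prop where
  ac2 : IsAC2 y
  fst : f =ᵐ[weightMeasure b₀] y
  snd : g =ᵐ[weightMeasure b₀] diffExpr b₀ b₁ y
  left : y 0 = ∫ x, y x ∂ν₀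
  right : y 1 = ∫ x, y x ∂ν₁

/-! Linearity of the graph -/

theorem weightMeasure_ac : weightMeasure b₀ ≪ volume.restrict (Ioo 0 1) :=
  withDensity_absolutelyContinuous _ _

theorem IsAC2.ae_differentiable {y : ℝ → ℂ} (h : IsAC2 y) :
    ∀ᵐ x ∂volume.restrict (Ioo (0 : ℝ) 1), x ∈ Icc (0 : ℝ) 1 ∧
      DifferentiableWithinAt ℝ y (Icc 0 1) x ∧
      DifferentiableWithinAt ℝ (der y) (Icc 0 1) x := by
  have h1 := h.ac_der.boundedVariationOn.ae_differentiableAt_of_mem_uIcc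
  filter_upwards [ae_restrict_of_ae h1, ae_restrict_mem measurableSet_Ioo] with x hx hx'
  have hm : x ∈ Icc (0 : ℝ) 1 := Ioo_subset_Icc_self hx'
  refine ⟨hm, h.differentiableOn x hm, (hx ?_).differentiableWithinAt⟩
  rwa [uIcc_of_le zero_le_one]

theorem integrable_of_continuousOn {y : ℝ → ℂ} (h : ContinuousOn y (Icc 0 1))
    (ν : Measure (Ioo (0 : ℝ) 1)) [IsFiniteMeasure ν] :
    Integrable (fun x : Ioo (0 : ℝ) 1 => y x) ν := by
  obtain ⟨C, hC⟩ := isCompact_Icc.exists_bound_of_continuousOn h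
  refine Integrable.of_bound (C := C) ?_ (.of_forall fun x => hC x (Ioo_subset_Icc_self x.2))
  have : Continuous fun x : Ioo (0 : ℝ) 1 => y x :=
    (h.mono Ioo_subset_Icc_self).domRestrict
  exact this.aestronglyMeasurable

theorem der_add {y z : ℝ → ℂ} (hy : DifferentiableOn ℝ y (Icc 0 1))
    (hz : DifferentiableOn ℝ z (Icc 0 1)) :
    EqOn (der (y + z)) (der y + der z) (Icc 0 1) :=
  fun x hx => derivWithin_add (hy x hx) (hz x hx)

theorem der_smul {y : ℝ → ℂ} (c : ℂ) (hy : DifferentiableOn ℝ y (Icc 0 1)) :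
    EqOn (der (c • y)) (c • der y) (Icc 0 1) :=
  fun x hx => derivWithin_const_smul c (hy x hx)

theorem ac_congr {y z : ℝ → ℂ} (h : EqOn y z (Icc 0 1))
    (hy : AbsolutelyContinuousOnInterval y 0 1) : AbsolutelyContinuousOnInterval z 0 1 := by
  rw [absolutelyContinuousOnInterval_iff] at hy ⊢
  intro ε hε
  obtain ⟨δ, hδ, H⟩ := hy ε hε
  refine ⟨δ, hδ, fun E hE hs => ?_⟩
  have := H E hE hs
  rw [Finset.sum_congr rfl] at this
  · exact this
  · intro i hi
    have := hE.1 i hi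
    rw [uIcc_of_le zero_le_one] at this
    rw [h this.1, h this.2]

theorem IsAC2.add {y z : ℝ → ℂ} (hy : IsAC2 y) (hz : IsAC2 z) : IsAC2 (y + z) where
  differentiableOn := hy.differentiableOn.add hz.differentiableOn
  ac := hy.ac.add hz.ac
  ac_der := ac_congr (der_add hy.differentiableOn hz.differentiableOn).symm
    (hy.ac_der.add hz.ac_der)

theorem IsAC2.smul {y : ℝ → ℂ} (c : ℂ) (hy : IsAC2 y) : IsAC2 (c • y) where
  differentiableOn := hy.differentiableOn.const_smul c
  ac := hy.ac.const_smul c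
  ac_der := ac_congr (der_smul c hy.differentiableOn).symm (hy.ac_der.const_smul c)

theorem diffExpr_add {y z : ℝ → ℂ} (hy : IsAC2 y) (hz : IsAC2 z) :
    diffExpr b₀ b₁ (y + z) =ᵐ[volume.restrict (Ioo 0 1)]
      diffExpr b₀ b₁ y + diffExpr b₀ b₁ z := by
  have h := der_add hy.differentiableOn hz.differentiableOn
  filter_upwards [hy.ae_differentiable, hz.ae_differentiable] with x hx hx'
  have h2 : der (der (y + z)) x = der (der y) x + der (der z) x := by
    rw [der, derivWithin_congr h (h hx.1)]
    exact derivWithin_add hx.2.2 hx'.2.2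
  simp only [diffExpr, Pi.add_apply, h2, h hx.1]
  ring

theorem diffExpr_smul {y : ℝ → ℂ} (c : ℂ) (hy : IsAC2 y) :
    diffExpr b₀ b₁ (c • y) =ᵐ[volume.restrict (Ioo 0 1)] c • diffExpr b₀ b₁ y := by
  have h := der_smul c hy.differentiableOn
  filter_upwards [hy.ae_differentiable] with x hx
  have h2 : der (der (c • y)) x = c • der (der y) x := by
    rw [der, derivWithin_congr h (h hx.1)]
    exact derivWithin_const_smul c hx.2.2
  simp only [diffExpr, Pi.smul_apply, h2, h hx.1, smul_eq_mul]
  ring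

theorem IsGraphPair.add [IsProbabilityMeasure ν₀] [IsProbabilityMeasure ν₁]
    {f g f' g' : WeightedL2 b₀} {y z : ℝ → ℂ} (h : IsGraphPair b₀ b₁ ν₀ ν₁ f g y)
    (h' : IsGraphPair b₀ b₁ ν₀ ν₁ f' g' z) :
    IsGraphPair b₀ b₁ ν₀ ν₁ (f + f') (g + g') (y + z) where
  ac2 := h.ac2.add h'.ac2
  fst := (Lp.coeFn_add f f').trans (h.fst.add h'.fst)
  snd := (Lp.coeFn_add g g').trans ((h.snd.add h'.snd).trans
    ((weightMeasure_ac b₀).ae_eq (diffExpr_add b₀ b₁ h.ac2 h'.ac2)).symm)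
  left := by
    simp only [Pi.add_apply]
    rw [integral_add (integrable_of_continuousOn h.ac2.differentiableOn.continuousOn ν₀)
      (integrable_of_continuousOn h'.ac2.differentiableOn.continuousOn ν₀), h.left, h'.left]
  right := by
    simp only [Pi.add_apply]
    rw [integral_add (integrable_of_continuousOn h.ac2.differentiableOn.continuousOn ν₁)
      (integrable_of_continuousOn h'.ac2.differentiableOn.continuousOn ν₁), h.right, h'.right]

theorem IsGraphPair.smul {f g : WeightedL2 b₀} {y : ℝ → ℂ} (c : ℂ)
    (h : IsGraphPair b₀ b₁ ν₀ ν₁ f g y) :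
    IsGraphPair b₀ b₁ ν₀ ν₁ (c • f) (c • g) (c • y) where
  ac2 := h.ac2.smul c
  fst := (Lp.coeFn_smul c f).trans (h.fst.const_smul c)
  snd := (Lp.coeFn_smul c g).trans ((h.snd.const_smul c).trans
    ((weightMeasure_ac b₀).ae_eq (diffExpr_smul b₀ b₁ c h.ac2)).symm)
  left := by
    simp only [Pi.smul_apply]
    rw [integral_smul, h.left]
  right := by
    simp only [Pi.smul_apply]
    rw [integral_smul, h.right]

theorem der_zero : der 0 = 0 := by
  funext x
  simp [der]

theorem IsGraphPair.zero : IsGraphPair b₀ b₁ ν₀ ν₁ 0 0 0 where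
  ac2 :=
    { differentiableOn := differentiableOn_const 0
      ac := (contDiffOn_const (c := (0 : ℂ))).absolutelyContinuousOnInterval
      ac_der := by
        rw [der_zero]
        exact (contDiffOn_const (c := (0 : ℂ))).absolutelyContinuousOnInterval }
  fst := Lp.coeFn_zero ..
  snd := by
    have : diffExpr b₀ b₁ 0 = 0 := by
      funext x
      simp [diffExpr, der_zero]
    rw [this]
    exact Lp.coeFn_zero ..
  left := by simp
  right := by simp

variable [IsProbabilityMeasure ν₀] [IsProbabilityMeasure ν₁]

/-- The graph of `L`. -/
def graph : Submodule ℂ (WeightedL2 b₀ × WeightedL2 b₀) where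
  carrier := {p | ∃ y, IsGraphPair b₀ b₁ ν₀ ν₁ p.1 p.2 y}
  add_mem' := by
    rintro p q ⟨y, hy⟩ ⟨z, hz⟩
    exact ⟨y + z, hy.add b₀ b₁ ν₀ ν₁ hz⟩
  zero_mem' := ⟨0, IsGraphPair.zero b₀ b₁ ν₀ ν₁⟩
  smul_mem' := by
    rintro c p ⟨y, hy⟩
    exact ⟨c • y, hy.smul b₀ b₁ ν₀ ν₁ c⟩

/-- The operator `L` in `L²_w`: `dom L` is the set of classes of functions `y` with
`y, y' ∈ AC[0,1]`, `l y ∈ L²_w`, `y 0 = ∫ y dν₀`, `y 1 = ∫ y dν₁`, and `L y = l y`. -/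
def operator : WeightedL2 b₀ →ₗ.[ℂ] WeightedL2 b₀ :=
  (graph b₀ b₁ ν₀ ν₁).toLinearPMap

/-- `L` is well defined: its graph is the one it was built from. -/
theorem operator_graph (hb₀ : ∀ᵐ x ∂volume.restrict (Ioo (0 : ℝ) 1), b₀ x < 0)
    (hw : IntegrableOn (fun x => -1 / b₀ x) (Ioo 0 1)) :
    (operator b₀ b₁ ν₀ ν₁).graph = graph b₀ b₁ ν₀ ν₁ := by
  refine Submodule.toLinearPMap_graph_eq _ ?_
  rintro ⟨f, g⟩ ⟨y, hy⟩ (rfl : f = 0)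
  have hac : volume.restrict (Ioo (0 : ℝ) 1) ≪ weightMeasure b₀ := by
    refine withDensity_absolutelyContinuous' hw.aemeasurable.ennreal_ofReal ?_
    filter_upwards [hb₀] with x hx
    simp only [ne_eq, ENNReal.ofReal_eq_zero, not_le]
    exact div_pos_of_neg_of_neg (by norm_num) hx
  have h0 : y =ᵐ[volume.restrict (Ioo (0 : ℝ) 1)] 0 :=
    hac.ae_eq (hy.fst.symm.trans (Lp.coeFn_zero ..))
  have h1 : EqOn y 0 (Ioo 0 1) :=
    Measure.eqOn_open_of_ae_eq h0 isOpen_Ioo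
      (hy.ac2.differentiableOn.continuousOn.mono Ioo_subset_Icc_self) continuousOn_const
  have key : ∀ z : ℝ → ℂ, EqOn z 0 (Ioo 0 1) → EqOn (der z) 0 (Ioo 0 1) := by
    intro z hz x hx
    rw [der, derivWithin_of_mem_nhds (Icc_mem_nhds hx.1 hx.2),
      Filter.EventuallyEq.deriv_eq (Filter.eventuallyEq_of_mem (Ioo_mem_nhds hx.1 hx.2) hz)]
    simp
  refine (Lp.eq_zero_iff_ae_eq_zero).2 (hy.snd.trans ((weightMeasure_ac b₀).ae_eq ?_))
  filter_upwards [ae_restrict_mem measurableSet_Ioo] with x hx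
  simp [diffExpr, key _ h1 hx, key _ (key _ h1) hx]

/-! ### Fundamental solutions and the characteristic function -/

/-- `y` solves `b₀ y'' + b₁ y' = z y` almost everywhere, with `y 0 = h` and `y' 0 = k`. -/
structure IsSolution (z h k : ℂ) (y : ℝ → ℂ) : Prop where
  ac2 : IsAC2 y
  eq : ∀ᵐ x ∂volume.restrict (Ioo (0 : ℝ) 1), diffExpr b₀ b₁ y x = z * y x
  init : y 0 = h
  init_der : der y 0 = k

/-- The solution of the initial value problem (unique on `[0,1]`). -/
def solution (z h k : ℂ) : ℝ → ℂ := Classical.epsilon (IsSolution b₀ b₁ z h k)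

/-- The fundamental solution with `y₁ 0 = 1`, `y₁' 0 = 0`. -/
def y₁ (z : ℂ) : ℝ → ℂ := solution b₀ b₁ z 1 0

/-- The fundamental solution with `y₂ 0 = 0`, `y₂' 0 = 1`. -/
def y₂ (z : ℂ) : ℝ → ℂ := solution b₀ b₁ z 0 1

/-- The characteristic function `Δ`. -/
def charFun (z : ℂ) : ℂ :=
  Matrix.det !![(∫ x, y₁ b₀ b₁ z x ∂ν₀) - 1, ∫ x, y₂ b₀ b₁ z x ∂ν₀;
    (∫ x, y₁ b₀ b₁ z x ∂ν₁) - y₁ b₀ b₁ z 1, (∫ x, y₂ b₀ b₁ z x ∂ν₁) - y₂ b₀ b₁ z 1]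

end Diffusion

end

/-!
The algebraic multiplicity is computed by expanding solutions in the spectral parameter at `z₀`.

*Solutions.* With the integrating factor `e^Q`, `Q = ∫ b₁ / b₀`, the equation
`b₀ y'' + b₁ y' = f` becomes `(e^Q y')' = e^Q f / b₀`. Hence its solution is a linear function of
the initial data and of `f`, given by two integrations, and the operator `K` which sends `f` to the
solution with zero initial data is a Volterra operator on `C[0,1]`: its powers decay like `Aⁿ / n!`
and `1 - z K` is always invertible. So at every `z₀` there are operators `Y` and `K` such that
`Y c + K f` is the solution of `(l - z₀) y = f` with initial data `c` (`exists_isSolutionPair`).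

*The characteristic function.* A solution at the parameter `z₀ + t` satisfies `v = Y c + t K v`, so
`v = ∑ tⁿ Kⁿ Y c` for small `t`. If `B` denotes the pair of boundary functionals, the Taylor series
of `Δ` at `z₀` is therefore `det F` with the matrix of power series `F = ∑ Xⁿ B Kⁿ Y`
(`isTaylorSeries_charFun`). In particular `Δ` is entire.

*Generalized eigenvectors.* The elements of `ker (L - z₀)ⁿ` are the sums `∑ Kᵐ Y c_m` over `m < n`
with coefficients such that the boundary conditions hold for the function and for all its images
under `l - z₀`. The operator `l - z₀` shifts the sequence `c` to the left. If power series act on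
finitely supported sequences with `X` as the left shift, the boundary conditions say exactly that
`F c = 0` (`mem_kerPow_iff`). Thus the generalized eigenspace is isomorphic to the kernel of `F`.

*Algebra.* Over the valuation ring of power series, `F` is equivalent to a diagonal matrix, and the
kernel of a power series `d` on finitely supported sequences has dimension `order d`, which is
infinite for `d = 0`. So the kernel of `F` has dimension `order (det F)`
(`toENat_rank_ker_matrixAction`), and this is the order of `Δ` at `z₀`.
-/

noncomputable section

/-! ### Formal power series acting on inverse polynomials -/

namespace PowerSeries

variable {k : Type*} [Field k]

/-- The pairing `⟨c, f⟩ = ∑ m, c m * f m` between finitely supported sequences and power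
series. -/
def pairing (f : k⟦X⟧) : (ℕ →₀ k) →ₗ[k] k :=
  Finsupp.linearCombination k fun m => coeff m f

theorem pairing_single (f : k⟦X⟧) (m : ℕ) (a : k) :
    pairing f (Finsupp.single m a) = a * coeff m f := by
  simp [pairing]

theorem pairing_X_pow (c : ℕ →₀ k) (j : ℕ) : pairing (X ^ j) c = c j := by
  rw [pairing, Finsupp.linearCombination_apply, Finsupp.sum, Finset.sum_eq_single j]
  · simp
  · intro b _ hb
    simp [coeff_X_pow, hb]
  · intro h
    simp [Finsupp.notMem_support_iff.1 h]

/-- The action of a power series `f` on `ℕ →₀ k`, where the basis vector `m` stands for `X ^ (-m)`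
in `k((X)) / X k⟦X⟧`. -/
def inverseSMul (f : k⟦X⟧) : (ℕ →₀ k) →ₗ[k] (ℕ →₀ k) :=
  Finsupp.linearCombination k fun m =>
    ∑ p ∈ Finset.HasAntidiagonal.antidiagonal m, Finsupp.single p.2 (coeff p.1 f)

theorem pairing_inverseSMul (f g : k⟦X⟧) (c : ℕ →₀ k) :
    pairing g (inverseSMul f c) = pairing (f * g) c := by
  induction c using Finsupp.induction_linear with
  | zero => simp
  | add c d hc hd => rw [map_add, map_add, map_add, hc, hd]
  | single m a =>
    rw [pairing_single, inverseSMul, Finsupp.linearCombination_single, map_smul, map_sum, coeff_mul]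
    simp [pairing_single]

theorem inverseSMul_apply (f : k⟦X⟧) (c : ℕ →₀ k) (j : ℕ) :
    inverseSMul f c j = pairing (f * X ^ j) c := by
  rw [← pairing_X_pow, pairing_inverseSMul]

theorem inverseSMul_apply_zero (f : k⟦X⟧) (c : ℕ →₀ k) : inverseSMul f c 0 = pairing f c := by
  simp [inverseSMul_apply]

theorem inverseSMul_X_pow_apply (c : ℕ →₀ k) (n j : ℕ) : inverseSMul (X ^ n) c j = c (n + j) := by
  rw [inverseSMul_apply, ← pow_add, pairing_X_pow]

/-- Finitely supported sequences as a module over the power series: multiplication by `X` is the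
shift to the left. -/
def inverseAction : k⟦X⟧ →+* Module.End k (ℕ →₀ k) where
  toFun := inverseSMul
  map_one' := by
    refine LinearMap.ext fun c => Finsupp.ext fun j => ?_
    simp [inverseSMul_apply, pairing_X_pow]
  map_mul' f g := by
    refine LinearMap.ext fun c => Finsupp.ext fun j => ?_
    rw [Module.End.mul_apply, inverseSMul_apply, inverseSMul_apply, pairing_inverseSMul]
    congr 2
    ring
  map_zero' := by
    refine LinearMap.ext fun c => Finsupp.ext fun j => ?_
    simp [inverseSMul_apply, pairing, Finsupp.linearCombination_apply]
  map_add' f g := by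
    refine LinearMap.ext fun c => Finsupp.ext fun j => ?_
    simp [inverseSMul_apply, pairing, add_mul, Finsupp.linearCombination_apply, Finsupp.sum,
      mul_add, Finset.sum_add_distrib]

theorem inverseAction_apply (f : k⟦X⟧) : inverseAction f = inverseSMul f := rfl

theorem _root_.LinearMap.ker_mul_of_isUnit {R M : Type*} [Ring R] [AddCommGroup M] [Module R M]
    {u : Module.End R M} (hu : IsUnit u) (f : Module.End R M) :
    LinearMap.ker (u * f) = LinearMap.ker f := by
  obtain ⟨u, rfl⟩ := hu
  ext x
  simp only [LinearMap.mem_ker, Module.End.mul_apply]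
  refine ⟨fun h => ?_, fun h => by rw [h, map_zero]⟩
  have := congrArg (u⁻¹ : (Module.End R M)ˣ).1 h
  rwa [map_zero, ← Module.End.mul_apply, Units.inv_mul] at this

theorem toENat_rank_ker_inverseAction (f : k⟦X⟧) :
    Cardinal.toENat (Module.rank k (LinearMap.ker (inverseAction f))) = f.order := by
  by_cases hf : f = 0
  · subst hf
    rw [map_zero, LinearMap.ker_zero, rank_top, rank_finsupp_self, order_zero]
    simp
  obtain ⟨g, hg, hfg⟩ : ∃ g : k⟦X⟧, IsUnit g ∧ f = g * X ^ f.order.toNat := by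
    refine ⟨divXPowOrder f, ?_, by rw [mul_comm, X_pow_order_mul_divXPowOrder]⟩
    rw [isUnit_iff_constantCoeff, isUnit_iff_ne_zero, Ne, constantCoeff_divXPowOrder_eq_zero_iff]
    exact hf
  have hker : LinearMap.ker (inverseAction f) =
      Finsupp.supported k k (Set.Iio f.order.toNat) := by
    rw [hfg, map_mul, LinearMap.ker_mul_of_isUnit (hg.map _), ← hfg]
    ext c
    simp only [LinearMap.mem_ker, Finsupp.mem_supported', Set.mem_Iio, not_lt,
      inverseAction_apply]
    rw [Finsupp.ext_iff]
    simp only [inverseSMul_X_pow_apply, Finsupp.coe_zero, Pi.zero_apply]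
    refine ⟨fun h j hj => ?_, fun h j => h _ (Nat.le_add_right _ _)⟩
    obtain ⟨i, rfl⟩ := Nat.exists_eq_add_of_le hj
    exact h i
  rw [hker, (Finsupp.supportedEquivFinsupp (Set.Iio f.order.toNat)).rank_eq, rank_finsupp_self]
  simp [coe_toNat_order hf]

/-! ### Matrices of power series -/

/-- A `2 × 2` matrix over a valuation ring is equivalent to a diagonal one. -/
theorem _root_.Matrix.exists_isUnit_mul_mul_eq_diagonal {R : Type*} [CommRing R] [IsDomain R]
    [ValuationRing R] (A : Matrix (Fin 2) (Fin 2) R) :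
    ∃ (P Q : Matrix (Fin 2) (Fin 2) R) (d : Fin 2 → R), IsUnit P ∧ IsUnit Q ∧
      P * A * Q = Matrix.diagonal d := by
  have key : ∀ A : Matrix (Fin 2) (Fin 2) R, A 0 0 ∣ A 0 1 → A 0 0 ∣ A 1 0 →
      ∃ (P Q : Matrix (Fin 2) (Fin 2) R) (d : Fin 2 → R), IsUnit P ∧ IsUnit Q ∧
        P * A * Q = Matrix.diagonal d := by
    rintro A ⟨r, hr⟩ ⟨s, hs⟩
    refine ⟨!![1, 0; -s, 1], !![1, -r; 0, 1], ![A 0 0, A 1 1 - s * A 0 0 * r], ?_, ?_, ?_⟩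
    · simp [Matrix.isUnit_iff_isUnit_det, Matrix.det_fin_two]
    · simp [Matrix.isUnit_iff_isUnit_det, Matrix.det_fin_two]
    · ext i j
      fin_cases i <;> fin_cases j <;>
        simp [Matrix.mul_apply, Matrix.vecMul, dotProduct, Fin.sum_univ_two, hr, hs] <;> ring
  have hw : IsUnit (!![0, 1; 1, 0] : Matrix (Fin 2) (Fin 2) R) := by
    simp [Matrix.isUnit_iff_isUnit_det, Matrix.det_fin_two]
  -- Row and column exchanges bring an entry that divides its row and its column to position `0 0`.
  have hrow : ∀ A : Matrix (Fin 2) (Fin 2) R, A 0 0 ∣ A 0 1 →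
      ∃ (P Q : Matrix (Fin 2) (Fin 2) R) (d : Fin 2 → R), IsUnit P ∧ IsUnit Q ∧
        P * A * Q = Matrix.diagonal d := by
    intro A h
    rcases ValuationRing.dvd_total (A 0 0) (A 1 0) with h' | h'
    · exact key A h h'
    rcases ValuationRing.dvd_total (A 1 0) (A 1 1) with h'' | h''
    · obtain ⟨P, Q, d, hP, hQ, e⟩ := key (!![0, 1; 1, 0] * A)
        (by simpa [Matrix.mul_apply, Matrix.vecMul, dotProduct, Fin.sum_univ_two] using h'')
        (by simpa [Matrix.mul_apply, Fin.sum_univ_two] using h')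
      exact ⟨P * !![0, 1; 1, 0], Q, d, hP.mul hw, hQ, by rw [← e]; simp only [Matrix.mul_assoc]⟩
    · obtain ⟨P, Q, d, hP, hQ, e⟩ := key (!![0, 1; 1, 0] * A * !![0, 1; 1, 0])
        (by simpa [Matrix.mul_apply, Matrix.vecMul, dotProduct, Fin.sum_univ_two] using h'')
        (by simpa [Matrix.mul_apply, Matrix.vecMul, dotProduct, Fin.sum_univ_two]
          using h''.trans (h'.trans h))
      exact ⟨P * !![0, 1; 1, 0], !![0, 1; 1, 0] * Q, d, hP.mul hw, hw.mul hQ, by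
        rw [← e]; simp only [Matrix.mul_assoc]⟩
  rcases ValuationRing.dvd_total (A 0 0) (A 0 1) with h | h
  · exact hrow A h
  · obtain ⟨P, Q, d, hP, hQ, e⟩ := hrow (A * !![0, 1; 1, 0])
      (by simpa [Matrix.mul_apply, Fin.sum_univ_two] using h)
    exact ⟨P, !![0, 1; 1, 0] * Q, d, hP, hw.mul hQ, by rw [← e]; simp only [Matrix.mul_assoc]⟩

/-- The action of matrices of power series on vectors of finitely supported sequences. -/
def matrixAction : Matrix (Fin 2) (Fin 2) k⟦X⟧ →+* Module.End k (Fin 2 → ℕ →₀ k) :=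
  (endVecRingEquivMatrixEnd (Fin 2) k (ℕ →₀ k)).symm.toRingHom.comp inverseAction.mapMatrix

theorem matrixAction_apply (A : Matrix (Fin 2) (Fin 2) k⟦X⟧) (c : Fin 2 → ℕ →₀ k) (i : Fin 2) :
    matrixAction A c i = ∑ j, inverseSMul (A i j) (c j) := rfl

theorem _root_.LinearMap.rank_ker_mul_of_isUnit {M : Type*} [AddCommGroup M] [Module k M]
    {u : Module.End k M} (hu : IsUnit u) (f : Module.End k M) :
    Module.rank k (LinearMap.ker (f * u)) = Module.rank k (LinearMap.ker f) := by
  obtain ⟨u, rfl⟩ := hu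
  let e : M ≃ₗ[k] M := LinearMap.GeneralLinearGroup.generalLinearEquiv k M u
  have h : LinearMap.ker (f * (u : Module.End k M)) =
      (LinearMap.ker f).comap (e : M →ₗ[k] M) := by
    ext x
    rfl
  rw [h]
  exact (e.ofSubmodule' (LinearMap.ker f)).rank_eq

theorem _root_.Submodule.rank_prod_eq_add {M : Type*} [AddCommGroup M] [Module k M]
    (p q : Submodule k M) :
    Module.rank k (p.prod q) = Module.rank k p + Module.rank k q := by
  let e : p.prod q ≃ₗ[k] p × q :=
    { toFun := fun x => (⟨x.1.1, x.2.1⟩, ⟨x.1.2, x.2.2⟩)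
      invFun := fun x => ⟨(x.1, x.2), x.1.2, x.2.2⟩
      map_add' := fun _ _ => rfl
      map_smul' := fun _ _ => rfl }
  rw [e.rank_eq, rank_prod']

theorem toENat_rank_ker_matrixAction (A : Matrix (Fin 2) (Fin 2) k⟦X⟧) :
    Cardinal.toENat (Module.rank k (LinearMap.ker (matrixAction A))) = A.det.order := by
  obtain ⟨P, Q, d, hP, hQ, e⟩ := A.exists_isUnit_mul_mul_eq_diagonal
  have hdet : A.det.order = (d 0).order + (d 1).order := by
    have h := congrArg (fun B => (Matrix.det B).order) e
    simp only [Matrix.det_mul, order_mul, Matrix.det_diagonal, Fin.prod_univ_two] at h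
    rwa [order_zero_of_unit ((Matrix.isUnit_iff_isUnit_det P).1 hP),
      order_zero_of_unit ((Matrix.isUnit_iff_isUnit_det Q).1 hQ), zero_add, add_zero] at h
  have hrank : Module.rank k (LinearMap.ker (matrixAction A)) =
      Module.rank k (LinearMap.ker (matrixAction (Matrix.diagonal d))) := by
    rw [← e, map_mul, LinearMap.rank_ker_mul_of_isUnit (hQ.map _), map_mul,
      LinearMap.ker_mul_of_isUnit (hP.map _)]
  have hker : LinearMap.ker (matrixAction (Matrix.diagonal d)) =
      ((LinearMap.ker (inverseAction (d 0))).prod (LinearMap.ker (inverseAction (d 1)))).comap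
        (LinearEquiv.finTwoArrow k (ℕ →₀ k) : (Fin 2 → ℕ →₀ k) →ₗ[k] _) := by
    ext c
    simp only [LinearMap.mem_ker, Submodule.mem_comap, Submodule.mem_prod, funext_iff,
      matrixAction_apply, Fin.forall_fin_two, Fin.sum_univ_two]
    simp [← inverseAction_apply]
  rw [hrank, hker, ((LinearEquiv.finTwoArrow k (ℕ →₀ k)).ofSubmodule' _).rank_eq,
    Submodule.rank_prod_eq_add, map_add, toENat_rank_ker_inverseAction,
    toENat_rank_ker_inverseAction, hdet]

end PowerSeries

/-! ### Taylor expansions -/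

namespace PowerSeries

/-- `P` is the Taylor series of `f` at `z₀`: it converges absolutely to `f` near `z₀`. -/
def IsTaylorSeries (P : ℂ⟦X⟧) (f : ℂ → ℂ) (z₀ : ℂ) : Prop :=
  ∀ᶠ t in 𝓝 (0 : ℂ), (Summable fun n => ‖coeff n P * t ^ n‖) ∧
    f (z₀ + t) = ∑' n, coeff n P * t ^ n

namespace IsTaylorSeries

variable {P P' : ℂ⟦X⟧} {f f' : ℂ → ℂ} {z₀ : ℂ}

theorem sub (h : IsTaylorSeries P f z₀) (h' : IsTaylorSeries P' f' z₀) :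
    IsTaylorSeries (P - P') (f - f') z₀ := by
  filter_upwards [h, h'] with t ht ht'
  have h1 := ht.1.of_norm
  have h2 := ht'.1.of_norm
  refine ⟨?_, ?_⟩
  · simp only [map_sub, sub_mul]
    exact Summable.of_nonneg_of_le (fun _ => norm_nonneg _) (fun _ => norm_sub_le _ _)
      (ht.1.add ht'.1)
  · simp only [map_sub, sub_mul, Pi.sub_apply, h1.tsum_sub h2, ht.2, ht'.2]

theorem mul (h : IsTaylorSeries P f z₀) (h' : IsTaylorSeries P' f' z₀) :
    IsTaylorSeries (P * P') (f * f') z₀ := by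
  filter_upwards [h, h'] with t ht ht'
  have key : ∀ n, coeff n (P * P') * t ^ n = ∑ p ∈ Finset.HasAntidiagonal.antidiagonal n,
      coeff p.1 P * t ^ p.1 * (coeff p.2 P' * t ^ p.2) := by
    intro n
    rw [coeff_mul, Finset.sum_mul]
    refine Finset.sum_congr rfl fun p hp => ?_
    rw [← Finset.HasAntidiagonal.mem_antidiagonal.1 hp, pow_add]
    ring
  have h1 := summable_norm_sum_mul_antidiagonal_of_summable_norm
    (f := fun n => coeff n P * t ^ n) (g := fun n => coeff n P' * t ^ n) ht.1 ht'.1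
  have h2 := tsum_mul_tsum_eq_tsum_sum_antidiagonal_of_summable_norm
    (f := fun n => coeff n P * t ^ n) (g := fun n => coeff n P' * t ^ n) ht.1 ht'.1
  refine ⟨h1.congr fun n => by rw [key], ?_⟩
  rw [Pi.mul_apply, ht.2, ht'.2, h2]
  exact tsum_congr fun n => (key n).symm

theorem hasFPowerSeriesAt (h : IsTaylorSeries P f z₀) :
    HasFPowerSeriesAt f (FormalMultilinearSeries.ofScalars ℂ fun n => coeff n P) z₀ := by
  rw [hasFPowerSeriesAt_iff]
  filter_upwards [h] with t ht
  rw [ht.2]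
  simpa [mul_comm, FormalMultilinearSeries.coeff_ofScalars] using ht.1.of_norm.hasSum

theorem analyticOrderAt_eq (h : IsTaylorSeries P f z₀) : analyticOrderAt f z₀ = P.order := by
  have hp := h.hasFPowerSeriesAt
  set p := FormalMultilinearSeries.ofScalars ℂ fun n => coeff n P with hpdef
  have hz : ∀ n, p n = 0 ↔ coeff n P = 0 := fun n =>
    FormalMultilinearSeries.ofScalars_eq_zero ..
  by_cases hP : P = 0
  · have : p = 0 := by
      funext n
      exact (hz n).2 (by simp [hP])
    rw [hP, order_zero, analyticOrderAt_eq_top, hp.locally_zero_iff, this]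
  have hp0 : p ≠ 0 := by
    intro h0
    exact coeff_order hP ((hz _).1 (by rw [h0]; rfl))
  have hord : P.order = p.order := by
    rw [order_eq_nat]
    exact ⟨fun h0 => p.apply_order_ne_zero hp0 ((hz _).2 h0),
      fun i hi => (hz i).1 (p.apply_eq_zero_of_lt_order hi)⟩
  rw [hord, hp.analyticAt.analyticOrderAt_eq_natCast]
  exact ⟨_, (hp.has_fpower_series_iterate_dslope_fslope p.order).analyticAt,
    hp.iterate_dslope_fslope_ne_zero hp0, .of_forall hp.eq_pow_order_mul_iterate_dslope⟩

end IsTaylorSeries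

end PowerSeries

namespace Diffusion

/-! ### Absolutely continuous functions -/

theorem _root_.LipschitzOnWith.comp_absolutelyContinuousOnInterval {X Y : Type*}
    [PseudoMetricSpace X] [PseudoMetricSpace Y] {K : NNReal} {s : Set X} {g : X → Y} {f : ℝ → X}
    {a b : ℝ} (hg : LipschitzOnWith K g s) (hf : AbsolutelyContinuousOnInterval f a b)
    (hs : MapsTo f (uIcc a b) s) : AbsolutelyContinuousOnInterval (g ∘ f) a b := by
  rw [absolutelyContinuousOnInterval_iff] at hf ⊢
  intro ε hε
  obtain ⟨δ, hδ, H⟩ := hf (ε / (K + 1)) (by positivity)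
  refine ⟨δ, hδ, fun E hE hs' => ?_⟩
  calc ∑ i ∈ Finset.range E.1, dist ((g ∘ f) (E.2 i).1) ((g ∘ f) (E.2 i).2)
      ≤ ∑ i ∈ Finset.range E.1, (K + 1 : ℝ) * dist (f (E.2 i).1) (f (E.2 i).2) := by
        refine Finset.sum_le_sum fun i hi => ?_
        refine (hg.dist_le_mul _ (hs (hE.1 i hi).1) _ (hs (hE.1 i hi).2)).trans ?_
        gcongr
        simp
    _ < (K + 1 : ℝ) * (ε / (K + 1)) := by
        rw [← Finset.mul_sum]
        exact mul_lt_mul_of_pos_left (H E hE hs') (by positivity)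
    _ = ε := by field_simp

theorem ac_cexp {f : ℝ → ℂ} {a b : ℝ} (hf : AbsolutelyContinuousOnInterval f a b) :
    AbsolutelyContinuousOnInterval (fun x => Complex.exp (f x)) a b := by
  obtain ⟨C, hC⟩ := hf.exists_bound
  have h : ContDiffOn ℝ 1 Complex.exp (Metric.closedBall 0 C) := Complex.contDiff_exp.contDiffOn
  obtain ⟨K, hK⟩ := h.exists_lipschitzOnWith (by decide) (convex_closedBall _ _)
    (isCompact_closedBall _ _)
  exact hK.comp_absolutelyContinuousOnInterval hf fun x hx => by simpa using hC x hx

theorem ac_primitive {g : ℝ → ℂ} (hg : IntervalIntegrable g volume 0 1) :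
    AbsolutelyContinuousOnInterval (fun x => ∫ t in (0 : ℝ)..x, g t) 0 1 := by
  have hre : IntervalIntegrable (fun x => (g x).re) volume 0 1 :=
    ⟨hg.1.re, hg.2.re⟩
  have him : IntervalIntegrable (fun x => (g x).im) volume 0 1 :=
    ⟨hg.1.im, hg.2.im⟩
  have hof : ∀ {u : ℝ → ℝ}, AbsolutelyContinuousOnInterval u 0 1 →
      AbsolutelyContinuousOnInterval (fun x => (u x : ℂ)) 0 1 := fun hu =>
    LipschitzOnWith.comp_absolutelyContinuousOnInterval
      (Complex.isometry_ofReal.lipschitz.lipschitzOnWith (s := univ)) hu (mapsTo_univ _ _)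
  have h := (hof (hre.absolutelyContinuousOnInterval_intervalIntegral (c := 0) (by simp))).add
    ((hof (him.absolutelyContinuousOnInterval_intervalIntegral (c := 0) (by simp))).const_smul
      Complex.I)
  refine ac_congr (fun x hx => ?_) h
  have hsub : uIcc 0 x ⊆ uIcc (0 : ℝ) 1 := by
    rw [uIcc_of_le hx.1, uIcc_of_le zero_le_one]
    exact Icc_subset_Icc_right hx.2
  have h1 : IntervalIntegrable (fun t => ((g t).re : ℂ)) volume 0 x :=
    ⟨(hre.mono_set hsub).1.ofReal, (hre.mono_set hsub).2.ofReal⟩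
  have h2 : IntervalIntegrable (fun t => ((g t).im : ℂ)) volume 0 x :=
    ⟨(him.mono_set hsub).1.ofReal, (him.mono_set hsub).2.ofReal⟩
  simp only [Pi.add_apply, smul_eq_mul, ← intervalIntegral.integral_ofReal]
  rw [← intervalIntegral.integral_const_mul,
    ← intervalIntegral.integral_add h1 (h2.const_mul _)]
  refine intervalIntegral.integral_congr fun t _ => ?_
  simp [mul_comm Complex.I, Complex.re_add_im]

theorem ae_restrict_Ioo_iff {p : ℝ → Prop} :
    (∀ᵐ x ∂volume.restrict (Ioo (0 : ℝ) 1), p x) ↔ ∀ᵐ x, x ∈ uIcc (0 : ℝ) 1 → p x := by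
  rw [uIcc_of_le zero_le_one, ← ae_restrict_iff' measurableSet_Icc,
    Measure.restrict_congr_set Ioo_ae_eq_Icc]

theorem der_eq_of_hasDerivAt {y : ℝ → ℂ} {d : ℂ} {x : ℝ} (hx : x ∈ Icc (0 : ℝ) 1)
    (h : HasDerivAt y d x) : der y x = d :=
  h.hasDerivWithinAt.derivWithin (uniqueDiffOn_Icc zero_lt_one x hx)

theorem der_congr {y z : ℝ → ℂ} (h : EqOn y z (Icc 0 1)) : EqOn (der y) (der z) (Icc 0 1) :=
  fun _ hx => derivWithin_congr h (h hx)

theorem IsAC2.congr {y z : ℝ → ℂ} (hy : IsAC2 y) (h : EqOn y z (Icc 0 1)) : IsAC2 z where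
  differentiableOn := hy.differentiableOn.congr fun _ hx => (h hx).symm
  ac := ac_congr h hy.ac
  ac_der := ac_congr (der_congr h) hy.ac_der

theorem diffExpr_congr (b₀ : ℝ → ℝ) (b₁ : ℝ → ℂ) {y z : ℝ → ℂ} (h : EqOn y z (Icc 0 1)) :
    EqOn (diffExpr b₀ b₁ y) (diffExpr b₀ b₁ z) (Icc 0 1) := fun x hx => by
  simp only [diffExpr, der_congr h hx, der_congr (der_congr h) hx]

theorem IsAC2.ae_hasDerivAt_der {y : ℝ → ℂ} (h : IsAC2 y) :
    ∀ᵐ x ∂volume.restrict (Ioo (0 : ℝ) 1), HasDerivAt (der y) (der (der y) x) x := by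
  have h1 := h.ac_der.boundedVariationOn.ae_differentiableAt_of_mem_uIcc
  filter_upwards [ae_restrict_Ioo_iff.2 h1, ae_restrict_mem measurableSet_Ioo] with x hx hx'
  rw [der_eq_of_hasDerivAt (Ioo_subset_Icc_self hx') hx.hasDerivAt]
  exact hx.hasDerivAt

/-! ### The equation with a right-hand side -/

/-- The coefficient `b₁ / b₀`, extended by zero to the real line. -/
def driftCoeff (b₀ : ℝ → ℝ) (b₁ : ℝ → ℂ) : ℝ → ℂ :=
  (Ioo (0 : ℝ) 1).indicator fun x => b₁ x / (b₀ x : ℂ)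

/-- The coefficient `1 / b₀`, extended by zero to the real line. -/
def invCoeff (b₀ : ℝ → ℝ) : ℝ → ℂ :=
  (Ioo (0 : ℝ) 1).indicator fun x => 1 / (b₀ x : ℂ)

/-- The function `∫₀ˣ b₁ / b₀`, whose exponential is the integrating factor of the equation. -/
def logFactor (b₀ : ℝ → ℝ) (b₁ : ℝ → ℂ) (x : ℝ) : ℂ := ∫ t in (0 : ℝ)..x, driftCoeff b₀ b₁ t

/-- The function `∫₀ˣ e^Q f / b₀`, where `Q = ∫ b₁ / b₀`: up to a constant, this is `e^Q y'` for a
solution of `b₀ y'' + b₁ y' = f`. -/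
def flux (b₀ : ℝ → ℝ) (b₁ : ℝ → ℂ) (f : ℝ → ℂ) (x : ℝ) : ℂ :=
  ∫ t in (0 : ℝ)..x, invCoeff b₀ t * Complex.exp (logFactor b₀ b₁ t) * f t

/-- The derivative of the solution of `b₀ y'' + b₁ y' = f`, `y' 0 = k`. -/
def forcedSolutionDer (b₀ : ℝ → ℝ) (b₁ : ℝ → ℂ) (k : ℂ) (f : ℝ → ℂ) (x : ℝ) : ℂ :=
  Complex.exp (-logFactor b₀ b₁ x) * (k + flux b₀ b₁ f x)

/-- The solution of `b₀ y'' + b₁ y' = f`, `y 0 = h`, `y' 0 = k`. -/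
def forcedSolution (b₀ : ℝ → ℝ) (b₁ : ℝ → ℂ) (h k : ℂ) (f : ℝ → ℂ) (x : ℝ) : ℂ :=
  h + ∫ t in (0 : ℝ)..x, forcedSolutionDer b₀ b₁ k f t

/-- `y` solves `b₀ y'' + b₁ y' = z y + f` almost everywhere, with `y 0 = c 0` and `y' 0 = c 1`. -/
structure IsForcedSolution (b₀ : ℝ → ℝ) (b₁ : ℝ → ℂ) (z : ℂ) (c : Fin 2 → ℂ) (f y : ℝ → ℂ) :
    Prop where
  ac2 : IsAC2 y
  eq : ∀ᵐ x ∂volume.restrict (Ioo (0 : ℝ) 1), diffExpr b₀ b₁ y x = z * y x + f x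
  init : y 0 = c 0
  init_der : der y 0 = c 1

variable {b₀ : ℝ → ℝ} {b₁ : ℝ → ℂ}

theorem IsForcedSolution.congr {z : ℂ} {c : Fin 2 → ℂ} {f y y' : ℝ → ℂ}
    (h : IsForcedSolution b₀ b₁ z c f y) (hy : EqOn y y' (Icc 0 1)) :
    IsForcedSolution b₀ b₁ z c f y' where
  ac2 := h.ac2.congr hy
  eq := by
    filter_upwards [h.eq, ae_restrict_mem measurableSet_Ioo] with x hx hx'
    have hx' := Ioo_subset_Icc_self hx'
    rw [← diffExpr_congr b₀ b₁ hy hx', hx, hy hx']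
  init := by rw [← hy (by simp), h.init]
  init_der := by rw [← der_congr hy (by simp), h.init_der]


theorem integrable_driftCoeff (hq : IntegrableOn (fun x => b₁ x / (b₀ x : ℂ)) (Ioo 0 1)) :
    Integrable (driftCoeff b₀ b₁) :=
  (integrable_indicator_iff measurableSet_Ioo).2 hq

theorem integrable_invCoeff (hw : IntegrableOn (fun x => -1 / b₀ x) (Ioo 0 1)) :
    Integrable (invCoeff b₀) := by
  refine (integrable_indicator_iff measurableSet_Ioo).2 ?_
  refine (hw.neg.ofReal (𝕜 := ℂ)).congr (.of_forall fun x => ?_)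
  simp [neg_div]

theorem continuous_logFactor (hq : IntegrableOn (fun x => b₁ x / (b₀ x : ℂ)) (Ioo 0 1)) :
    Continuous (logFactor b₀ b₁) :=
  intervalIntegral.continuous_primitive
    (fun _ _ => (integrable_driftCoeff hq).intervalIntegrable) 0

theorem intervalIntegrable_flux (hw : IntegrableOn (fun x => -1 / b₀ x) (Ioo 0 1))
    (hq : IntegrableOn (fun x => b₁ x / (b₀ x : ℂ)) (Ioo 0 1)) {f : ℝ → ℂ} (hf : Continuous f)
    (a b : ℝ) : IntervalIntegrable
      (fun t => invCoeff b₀ t * Complex.exp (logFactor b₀ b₁ t) * f t) volume a b := by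
  have h1 : IntervalIntegrable (invCoeff b₀) volume a b :=
    (integrable_invCoeff hw).intervalIntegrable
  have h2 : Continuous fun t => Complex.exp (logFactor b₀ b₁ t) * f t :=
    (continuous_logFactor hq).cexp.mul hf
  simpa only [mul_assoc] using h1.mul_continuousOn h2.continuousOn

theorem continuous_forcedSolutionDer (hw : IntegrableOn (fun x => -1 / b₀ x) (Ioo 0 1))
    (hq : IntegrableOn (fun x => b₁ x / (b₀ x : ℂ)) (Ioo 0 1)) (k : ℂ) {f : ℝ → ℂ}
    (hf : Continuous f) : Continuous (forcedSolutionDer b₀ b₁ k f) :=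
  (continuous_logFactor hq).neg.cexp.mul (continuous_const.add
    (intervalIntegral.continuous_primitive (intervalIntegrable_flux hw hq hf) 0))

theorem hasDerivAt_forcedSolution (hw : IntegrableOn (fun x => -1 / b₀ x) (Ioo 0 1))
    (hq : IntegrableOn (fun x => b₁ x / (b₀ x : ℂ)) (Ioo 0 1)) (h k : ℂ) {f : ℝ → ℂ}
    (hf : Continuous f) (x : ℝ) :
    HasDerivAt (forcedSolution b₀ b₁ h k f) (forcedSolutionDer b₀ b₁ k f x) x := by
  have hc := continuous_forcedSolutionDer hw hq k hf
  exact (intervalIntegral.integral_hasDerivAt_right (hc.intervalIntegrable _ _)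
    (hc.stronglyMeasurableAtFilter _ _) hc.continuousAt).const_add h

theorem der_forcedSolution (hw : IntegrableOn (fun x => -1 / b₀ x) (Ioo 0 1))
    (hq : IntegrableOn (fun x => b₁ x / (b₀ x : ℂ)) (Ioo 0 1)) (h k : ℂ) {f : ℝ → ℂ}
    (hf : Continuous f) :
    EqOn (der (forcedSolution b₀ b₁ h k f)) (forcedSolutionDer b₀ b₁ k f) (Icc 0 1) :=
  fun x hx => der_eq_of_hasDerivAt hx (hasDerivAt_forcedSolution hw hq h k hf x)

theorem ac_flux (hw : IntegrableOn (fun x => -1 / b₀ x) (Ioo 0 1))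
    (hq : IntegrableOn (fun x => b₁ x / (b₀ x : ℂ)) (Ioo 0 1)) {f : ℝ → ℂ} (hf : Continuous f) :
    AbsolutelyContinuousOnInterval (flux b₀ b₁ f) 0 1 :=
  ac_primitive (intervalIntegrable_flux hw hq hf 0 1)

theorem ac_logFactor (hq : IntegrableOn (fun x => b₁ x / (b₀ x : ℂ)) (Ioo 0 1)) :
    AbsolutelyContinuousOnInterval (logFactor b₀ b₁) 0 1 :=
  ac_primitive (integrable_driftCoeff hq).intervalIntegrable

theorem ae_hasDerivAt_logFactor (hq : IntegrableOn (fun x => b₁ x / (b₀ x : ℂ)) (Ioo 0 1)) :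
    ∀ᵐ x ∂volume.restrict (Ioo (0 : ℝ) 1),
      HasDerivAt (logFactor b₀ b₁) (b₁ x / (b₀ x : ℂ)) x := by
  have h : IntervalIntegrable (driftCoeff b₀ b₁) volume 0 1 :=
    (integrable_driftCoeff hq).intervalIntegrable
  filter_upwards [ae_restrict_Ioo_iff.2 h.ae_hasDerivAt_integral,
    ae_restrict_mem measurableSet_Ioo] with x hx hx'
  have := hx 0 (by simp)
  rwa [driftCoeff, indicator_of_mem hx'] at this

theorem ae_hasDerivAt_flux (hw : IntegrableOn (fun x => -1 / b₀ x) (Ioo 0 1))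
    (hq : IntegrableOn (fun x => b₁ x / (b₀ x : ℂ)) (Ioo 0 1)) {f : ℝ → ℂ} (hf : Continuous f) :
    ∀ᵐ x ∂volume.restrict (Ioo (0 : ℝ) 1), HasDerivAt (flux b₀ b₁ f)
      (1 / (b₀ x : ℂ) * Complex.exp (logFactor b₀ b₁ x) * f x) x := by
  filter_upwards [ae_restrict_Ioo_iff.2
    (intervalIntegrable_flux hw hq hf 0 1).ae_hasDerivAt_integral,
    ae_restrict_mem measurableSet_Ioo] with x hx hx'
  have := hx 0 (by simp)
  rwa [invCoeff, indicator_of_mem hx'] at this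

theorem isForcedSolution_forcedSolution
    (hb₀ : ∀ᵐ x ∂volume.restrict (Ioo (0 : ℝ) 1), b₀ x < 0)
    (hw : IntegrableOn (fun x => -1 / b₀ x) (Ioo 0 1))
    (hq : IntegrableOn (fun x => b₁ x / (b₀ x : ℂ)) (Ioo 0 1)) (c : Fin 2 → ℂ) {f : ℝ → ℂ}
    (hf : Continuous f) :
    IsForcedSolution b₀ b₁ 0 c f (forcedSolution b₀ b₁ (c 0) (c 1) f) where
  ac2 :=
    { differentiableOn := fun x _ =>
        (hasDerivAt_forcedSolution hw hq _ _ hf x).differentiableAt.differentiableWithinAt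
      ac := by
        refine AbsolutelyContinuousOnInterval.add (f := fun _ => c 0)
          (contDiffOn_const (c := c 0)).absolutelyContinuousOnInterval (ac_primitive ?_)
        exact (continuous_forcedSolutionDer hw hq _ hf).intervalIntegrable _ _
      ac_der := by
        refine ac_congr (der_forcedSolution hw hq (c 0) (c 1) hf).symm ?_
        exact (ac_cexp (ac_logFactor hq).neg).smul (AbsolutelyContinuousOnInterval.add
          (f := fun _ => c 1) (contDiffOn_const (c := c 1)).absolutelyContinuousOnInterval
          (ac_flux hw hq hf)) }
  eq := by
    filter_upwards [hb₀, ae_hasDerivAt_logFactor hq, ae_hasDerivAt_flux hw hq hf,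
      ae_restrict_mem measurableSet_Ioo] with x hb h1 h2 hx
    have hx := Ioo_subset_Icc_self hx
    have hb : (b₀ x : ℂ) ≠ 0 := by exact_mod_cast hb.ne
    have h3 : HasDerivAt (forcedSolutionDer b₀ b₁ (c 1) f) _ x := h1.neg.cexp.mul (h2.const_add _)
    have hd := der_forcedSolution hw hq (c 0) (c 1) hf
    rw [diffExpr, der_congr hd hx, hd hx, der_eq_of_hasDerivAt hx h3]
    simp only [forcedSolutionDer, Pi.neg_apply]
    have he : Complex.exp (-logFactor b₀ b₁ x) * Complex.exp (logFactor b₀ b₁ x) = 1 := by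
      rw [← Complex.exp_add, neg_add_cancel, Complex.exp_zero]
    field_simp
    linear_combination f x * he
  init := by simp [forcedSolution]
  init_der := by
    rw [der_forcedSolution hw hq (c 0) (c 1) hf (by simp)]
    simp [forcedSolutionDer, logFactor, flux]

theorem isForcedSolution_zero_iff
    (hb₀ : ∀ᵐ x ∂volume.restrict (Ioo (0 : ℝ) 1), b₀ x < 0)
    (hw : IntegrableOn (fun x => -1 / b₀ x) (Ioo 0 1))
    (hq : IntegrableOn (fun x => b₁ x / (b₀ x : ℂ)) (Ioo 0 1)) (c : Fin 2 → ℂ) {f y : ℝ → ℂ}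
    (hf : Continuous f) :
    IsForcedSolution b₀ b₁ 0 c f y ↔ EqOn (forcedSolution b₀ b₁ (c 0) (c 1) f) y (Icc 0 1) := by
  refine ⟨fun h => ?_, (isForcedSolution_forcedSolution hb₀ hw hq c hf).congr⟩
  have hexp : ∀ x, Complex.exp (-logFactor b₀ b₁ x) * Complex.exp (logFactor b₀ b₁ x) = 1 :=
    fun x => by rw [← Complex.exp_add, neg_add_cancel, Complex.exp_zero]
  -- By the equation, `e^Q y' - ∫ e^Q f / b₀` has derivative zero almost everywhere.
  have hac : AbsolutelyContinuousOnInterval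
      (fun x => Complex.exp (logFactor b₀ b₁ x) * der y x - flux b₀ b₁ f x) 0 1 :=
    ((ac_cexp (ac_logFactor hq)).smul h.ac2.ac_der).sub (ac_flux hw hq hf)
  obtain ⟨C, hC⟩ := hac.const_of_ae_hasDerivAt_zero <| ae_restrict_Ioo_iff.1 <| by
    filter_upwards [hb₀, ae_hasDerivAt_logFactor hq, ae_hasDerivAt_flux hw hq hf,
      h.ac2.ae_hasDerivAt_der, h.eq] with x hb h1 h2 h3 h4
    have hb : (b₀ x : ℂ) ≠ 0 := by exact_mod_cast hb.ne
    refine ((h1.cexp.mul h3).sub h2).congr_deriv ?_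
    rw [diffExpr, zero_mul, zero_add] at h4
    rw [← h4]
    field_simp
    ring
  rw [uIcc_of_le zero_le_one] at hC
  have hC0 : C = c 1 := by
    rw [← hC 0 (by simp), h.init_der]
    simp [logFactor, flux]
  have hder : EqOn (der y) (forcedSolutionDer b₀ b₁ (c 1) f) (Icc 0 1) := fun x hx => by
    have := hC x hx
    rw [forcedSolutionDer, ← hC0, ← this]
    linear_combination (-der y x) * hexp x
  have hdiff : DifferentiableOn ℝ (forcedSolution b₀ b₁ (c 0) (c 1) f) (Icc 0 1) := fun x _ =>
    (hasDerivAt_forcedSolution hw hq _ _ hf x).differentiableAt.differentiableWithinAt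
  have hconst := constant_of_derivWithin_zero (hdiff.sub h.ac2.differentiableOn) fun x hx => by
    have hx := Ico_subset_Icc_self hx
    rw [derivWithin_sub (hdiff x hx) (h.ac2.differentiableOn x hx)]
    exact sub_eq_zero.2 ((der_forcedSolution hw hq _ _ hf hx).trans (hder hx).symm)
  intro x hx
  have := hconst x hx
  simp only [Pi.sub_apply, h.init] at this
  simpa [forcedSolution, sub_eq_zero] using this

end Diffusion

namespace Diffusion

variable {b₀ : ℝ → ℝ} {b₁ : ℝ → ℂ}

/-! ### The Volterra operator -/

/-- The extension of a continuous function on `[0,1]` to the line, constant on either side. -/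
def extend (v : C(Icc (0 : ℝ) 1, ℂ)) : ℝ → ℂ := IccExtend zero_le_one v

theorem extend_of_mem (v : C(Icc (0 : ℝ) 1, ℂ)) {x : ℝ} (hx : x ∈ Icc (0 : ℝ) 1) :
    extend v x = v ⟨x, hx⟩ :=
  IccExtend_of_mem _ _ hx

theorem continuous_extend (v : C(Icc (0 : ℝ) 1, ℂ)) : Continuous (extend v) :=
  v.continuous.Icc_extend'

theorem extend_add (u v : C(Icc (0 : ℝ) 1, ℂ)) : extend (u + v) = extend u + extend v := rfl

theorem extend_smul (z : ℂ) (v : C(Icc (0 : ℝ) 1, ℂ)) : extend (z • v) = z • extend v := rfl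

theorem eqOn_extend_iff {u v : C(Icc (0 : ℝ) 1, ℂ)} :
    EqOn (extend u) (extend v) (Icc 0 1) ↔ u = v := by
  refine ⟨fun h => ContinuousMap.ext fun x => ?_, fun h => by rw [h]; exact eqOn_refl _ _⟩
  simpa [extend_of_mem _ x.2] using h x.2

theorem exists_eqOn_extend {y : ℝ → ℂ} (hy : ContinuousOn y (Icc 0 1)) :
    ∃ v : C(Icc (0 : ℝ) 1, ℂ), EqOn y (extend v) (Icc 0 1) :=
  ⟨⟨_, hy.domRestrict⟩, fun x hx => by rw [extend_of_mem _ hx]; rfl⟩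

theorem forcedSolution_add (hw : IntegrableOn (fun x => -1 / b₀ x) (Ioo 0 1))
    (hq : IntegrableOn (fun x => b₁ x / (b₀ x : ℂ)) (Ioo 0 1)) (h k h' k' : ℂ) {f g : ℝ → ℂ}
    (hf : Continuous f) (hg : Continuous g) (x : ℝ) :
    forcedSolution b₀ b₁ (h + h') (k + k') (f + g) x =
      forcedSolution b₀ b₁ h k f x + forcedSolution b₀ b₁ h' k' g x := by
  have h1 : ∀ x, flux b₀ b₁ (f + g) x = flux b₀ b₁ f x + flux b₀ b₁ g x := fun x => by
    rw [flux, flux, flux, ← intervalIntegral.integral_add (intervalIntegrable_flux hw hq hf _ _)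
      (intervalIntegrable_flux hw hq hg _ _)]
    simp only [Pi.add_apply, mul_add]
  have h2 : forcedSolutionDer b₀ b₁ (k + k') (f + g) =
      fun x => forcedSolutionDer b₀ b₁ k f x + forcedSolutionDer b₀ b₁ k' g x := by
    funext x
    simp only [forcedSolutionDer, h1]
    ring
  rw [forcedSolution, h2, intervalIntegral.integral_add
    ((continuous_forcedSolutionDer hw hq k hf).intervalIntegrable _ _)
    ((continuous_forcedSolutionDer hw hq k' hg).intervalIntegrable _ _)]
  simp only [forcedSolution]
  ring

theorem forcedSolution_smul (a h k : ℂ) (f : ℝ → ℂ) (x : ℝ) :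
    forcedSolution b₀ b₁ (a * h) (a * k) (a • f) x = a * forcedSolution b₀ b₁ h k f x := by
  have h1 : ∀ x, flux b₀ b₁ (a • f) x = a * flux b₀ b₁ f x := fun x => by
    rw [flux, flux, ← intervalIntegral.integral_const_mul]
    simp only [Pi.smul_apply, smul_eq_mul, mul_left_comm]
  have h2 : forcedSolutionDer b₀ b₁ (a * k) (a • f) =
      fun x => a * forcedSolutionDer b₀ b₁ k f x := by
    funext x
    simp only [forcedSolutionDer, h1]
    ring
  rw [forcedSolution, h2, intervalIntegral.integral_const_mul, forcedSolution]
  ring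

/-- The solution of `b₀ y'' + b₁ y' = f` on `[0,1]` with `y 0 = c 0` and `y' 0 = c 1`, as a
linear function of `(c, f)`. -/
def forcedSolutionMap (hw : IntegrableOn (fun x => -1 / b₀ x) (Ioo 0 1))
    (hq : IntegrableOn (fun x => b₁ x / (b₀ x : ℂ)) (Ioo 0 1)) :
    (Fin 2 → ℂ) × C(Icc (0 : ℝ) 1, ℂ) →ₗ[ℂ] C(Icc (0 : ℝ) 1, ℂ) where
  toFun p := ⟨fun x => forcedSolution b₀ b₁ (p.1 0) (p.1 1) (extend p.2) x,
    continuous_iff_continuousAt.2 fun x => ((hasDerivAt_forcedSolution hw hq _ _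
      (continuous_extend p.2) x).continuousAt).comp continuous_subtype_val.continuousAt⟩
  map_add' _ _ := ContinuousMap.ext fun x => forcedSolution_add hw hq _ _ _ _
    (continuous_extend _) (continuous_extend _) x
  map_smul' _ _ := ContinuousMap.ext fun x => forcedSolution_smul _ _ _ _ x

theorem eqOn_extend_forcedSolutionMap (hw : IntegrableOn (fun x => -1 / b₀ x) (Ioo 0 1))
    (hq : IntegrableOn (fun x => b₁ x / (b₀ x : ℂ)) (Ioo 0 1)) (c : Fin 2 → ℂ)
    (f : C(Icc (0 : ℝ) 1, ℂ)) :
    EqOn (extend (forcedSolutionMap hw hq (c, f))) (forcedSolution b₀ b₁ (c 0) (c 1) (extend f))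
      (Icc 0 1) :=
  fun _ hx => extend_of_mem _ hx

/-- The factor `1 / (n + 1)` gained at each step makes the iterates of the solution operator
decay like `1 / n!`. -/
theorem exists_norm_forcedSolution_le (hw : IntegrableOn (fun x => -1 / b₀ x) (Ioo 0 1))
    (hq : IntegrableOn (fun x => b₁ x / (b₀ x : ℂ)) (Ioo 0 1)) :
    ∃ A : ℝ, 0 ≤ A ∧ ∀ (f : ℝ → ℂ) (_ : Continuous f) (B : ℝ) (n : ℕ), 0 ≤ B →
      (∀ x ∈ Icc (0 : ℝ) 1, ‖f x‖ ≤ B * x ^ n) → ∀ x ∈ Icc (0 : ℝ) 1,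
        ‖forcedSolution b₀ b₁ 0 0 f x‖ ≤ A * B * (x ^ (n + 1) / (n + 1)) := by
  obtain ⟨C, hC⟩ := isCompact_Icc.exists_bound_of_continuousOn
    (continuous_logFactor hq).neg.cexp.continuousOn (s := Icc (0 : ℝ) 1)
  have hC0 : 0 ≤ C := (norm_nonneg _).trans (hC 0 (by simp))
  set r : ℝ → ℝ := fun t => ‖invCoeff b₀ t * Complex.exp (logFactor b₀ b₁ t)‖ with hr
  have hri : ∀ a b, IntervalIntegrable r volume a b := fun a b => by
    simpa [hr] using (intervalIntegrable_flux hw hq (f := fun _ => 1) continuous_const a b).norm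
  have hr0 : ∀ t, 0 ≤ r t := fun t => norm_nonneg _
  set D : ℝ := ∫ t in (0 : ℝ)..1, r t
  have hD : 0 ≤ D := intervalIntegral.integral_nonneg zero_le_one fun t _ => hr0 t
  refine ⟨C * D, by positivity, fun f hf B n hB hfB x hx => ?_⟩
  have hflux : ∀ s ∈ Icc (0 : ℝ) 1, ‖flux b₀ b₁ f s‖ ≤ D * (B * s ^ n) := by
    intro s hs
    calc ‖flux b₀ b₁ f s‖ ≤ ∫ t in (0 : ℝ)..s, r t * (B * s ^ n) := by
          refine intervalIntegral.norm_integral_le_of_norm_le hs.1 (.of_forall fun t ht => ?_)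
            ((hri _ _).mul_const _)
          rw [norm_mul]
          refine mul_le_mul_of_nonneg_left ((hfB t ⟨ht.1.le, ht.2.trans hs.2⟩).trans ?_) (hr0 t)
          have := pow_le_pow_left₀ ht.1.le ht.2 n
          gcongr
      _ = (∫ t in (0 : ℝ)..s, r t) * (B * s ^ n) := intervalIntegral.integral_mul_const _ _
      _ ≤ D * (B * s ^ n) := by
          have := pow_nonneg hs.1 n
          gcongr
          exact intervalIntegral.integral_mono_interval le_rfl hs.1 hs.2 (.of_forall hr0) (hri _ _)
  calc ‖forcedSolution b₀ b₁ 0 0 f x‖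
      ≤ ∫ s in (0 : ℝ)..x, C * D * B * s ^ n := by
        rw [forcedSolution, zero_add]
        refine intervalIntegral.norm_integral_le_of_norm_le hx.1 (.of_forall fun s hs => ?_)
          ((by fun_prop : Continuous fun s : ℝ => C * D * B * s ^ n).intervalIntegrable _ _)
        have hs : s ∈ Icc (0 : ℝ) 1 := ⟨hs.1.le, hs.2.trans hx.2⟩
        rw [forcedSolutionDer, zero_add, norm_mul]
        calc _ ≤ C * (D * (B * s ^ n)) := by
              gcongr
              · exact hC s hs
              · exact hflux s hs
          _ = _ := by ring
    _ = C * D * B * (x ^ (n + 1) / (n + 1)) := by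
        rw [intervalIntegral.integral_const_mul, integral_pow]
        simp

/-- The resolvent `(1 - z K)⁻¹` exists for every `z` if the powers of `K` decay like `Aⁿ / n!`. -/
theorem isUnit_one_sub_smul_of_norm_pow_le {R : Type*} [NormedRing R] [CompleteSpace R]
    [NormedAlgebra ℂ R] {K : R} {A : ℝ}
    (hK : ∀ n : ℕ, ‖K ^ n‖ ≤ A ^ n / n.factorial) (z : ℂ) : IsUnit (1 - z • K) := by
  obtain ⟨n, hn⟩ := ((FloorSemiring.tendsto_pow_div_factorial_atTop (‖z‖ * A)).eventually
    (gt_mem_nhds one_pos)).exists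
  -- `1 - (z K)ⁿ` is invertible for large `n`, and `1 - z K` divides it.
  have h1 : ‖(z • K) ^ n‖ < 1 := by
    rw [smul_pow, norm_smul, norm_pow]
    refine (mul_le_mul_of_nonneg_left (hK n) (by positivity)).trans_lt ?_
    rwa [← mul_div_assoc, ← mul_pow]
  have h2 : IsUnit ((1 - z • K) * ∑ i ∈ Finset.range n, (z • K) ^ i) := by
    rw [mul_neg_geom_sum]
    exact isUnit_one_sub_of_norm_lt_one h1
  refine (Commute.isUnit_mul_iff ?_ |>.1 h2).1
  rw [Commute, SemiconjBy, mul_neg_geom_sum, geom_sum_mul_neg]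

/-- The operator `f ↦ y`, where `b₀ y'' + b₁ y' = f` and `y 0 = y' 0 = 0`, is bounded and
quasinilpotent on `C[0,1]`. -/
theorem exists_volterra (hw : IntegrableOn (fun x => -1 / b₀ x) (Ioo 0 1))
    (hq : IntegrableOn (fun x => b₁ x / (b₀ x : ℂ)) (Ioo 0 1)) :
    ∃ K : C(Icc (0 : ℝ) 1, ℂ) →L[ℂ] C(Icc (0 : ℝ) 1, ℂ),
      (∀ f, K f = forcedSolutionMap hw hq (0, f)) ∧ ∀ z : ℂ, IsUnit (1 - z • K) := by
  obtain ⟨A, hA, H⟩ := exists_norm_forcedSolution_le hw hq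
  have step : ∀ (f : C(Icc (0 : ℝ) 1, ℂ)) (B : ℝ) (n : ℕ), 0 ≤ B → (∀ x, ‖f x‖ ≤ B * x.1 ^ n) →
      ∀ x, ‖forcedSolutionMap hw hq (0, f) x‖ ≤ A * B * (x.1 ^ (n + 1) / (n + 1)) := by
    intro f B n hB hf x
    refine H (extend f) (continuous_extend f) B n hB (fun x hx => ?_) x x.2
    rw [extend_of_mem f hx]
    exact hf ⟨x, hx⟩
  let K : C(Icc (0 : ℝ) 1, ℂ) →L[ℂ] C(Icc (0 : ℝ) 1, ℂ) :=
    ((forcedSolutionMap hw hq).comp (LinearMap.inr ℂ (Fin 2 → ℂ) _)).mkContinuous A fun f => by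
      refine (ContinuousMap.norm_le _ (by positivity)).2 fun x => ?_
      refine (step f ‖f‖ 0 (norm_nonneg _) (fun x => by simpa using f.norm_coe_le_norm x)
        x).trans ?_
      simpa using mul_le_of_le_one_right (by positivity : 0 ≤ A * ‖f‖) x.2.2
  refine ⟨K, fun f => rfl, fun z => isUnit_one_sub_smul_of_norm_pow_le
    (R := C(Icc (0 : ℝ) 1, ℂ) →L[ℂ] C(Icc (0 : ℝ) 1, ℂ)) (A := A) (fun n => ?_) z⟩
  have hpow : ∀ (n : ℕ) (f : C(Icc (0 : ℝ) 1, ℂ)) x,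
      ‖(K ^ n) f x‖ ≤ A ^ n / n.factorial * ‖f‖ * x.1 ^ n := by
    intro n f
    induction n with
    | zero => simpa using f.norm_coe_le_norm
    | succ n ih =>
      intro x
      rw [pow_succ']
      refine (step ((K ^ n) f) _ n (by positivity) ih x).trans_eq ?_
      rw [Nat.factorial_succ]
      push_cast
      field_simp
      ring
  refine ContinuousLinearMap.opNorm_le_bound _ (by positivity) fun f => ?_
  refine (ContinuousMap.norm_le _ (by positivity)).2 fun x => (hpow n f x).trans ?_
  exact mul_le_of_le_one_right (by positivity) (pow_le_one₀ x.2.1 x.2.2)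

/-- The operators `K` and `Y` describe all solutions at the parameter `z`: the solution of
`b₀ y'' + b₁ y' = z y + f` with initial data `c` is `Y c + K f`. -/
def IsSolutionPair (b₀ : ℝ → ℝ) (b₁ : ℝ → ℂ) (z : ℂ)
    (K : C(Icc (0 : ℝ) 1, ℂ) →L[ℂ] C(Icc (0 : ℝ) 1, ℂ))
    (Y : (Fin 2 → ℂ) →ₗ[ℂ] C(Icc (0 : ℝ) 1, ℂ)) : Prop :=
  ∀ c f y, IsForcedSolution b₀ b₁ z c (extend f) y ↔ EqOn y (extend (Y c + K f)) (Icc 0 1)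

theorem exists_isSolutionPair
    (hb₀ : ∀ᵐ x ∂volume.restrict (Ioo (0 : ℝ) 1), b₀ x < 0)
    (hw : IntegrableOn (fun x => -1 / b₀ x) (Ioo 0 1))
    (hq : IntegrableOn (fun x => b₁ x / (b₀ x : ℂ)) (Ioo 0 1)) (z : ℂ) :
    ∃ K Y, IsSolutionPair b₀ b₁ z K Y := by
  obtain ⟨K, hK, hunit⟩ := exists_volterra hw hq
  obtain ⟨R, hR⟩ := hunit z
  let G : (Fin 2 → ℂ) →ₗ[ℂ] C(Icc (0 : ℝ) 1, ℂ) :=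
    (forcedSolutionMap hw hq).comp (LinearMap.inl ℂ _ _)
  have hGK : ∀ c f, forcedSolutionMap hw hq (c, f) = G c + K f := fun c f => by
    rw [hK, LinearMap.comp_apply, ← map_add]
    simp
  refine ⟨(R⁻¹).1 * K, (R⁻¹).1.toLinearMap.comp G, fun c f y => ?_⟩
  have hv : ∀ v, v = G c + K (f + z • v) ↔ v = (R⁻¹).1 (G c) + (R⁻¹).1 (K f) := by
    intro v
    have h1 : v = G c + K (f + z • v) ↔ R.1 v = G c + K f := by
      rw [hR, map_add, map_smul]
      simp only [sub_apply, one_apply_eq_self,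
        smul_apply]
      rw [sub_eq_iff_eq_add, add_assoc]
    have h2 : ∀ u, (R⁻¹).1 (R.1 u) = u := fun u => by
      rw [← mul_apply_eq_comp, Units.inv_mul, one_apply_eq_self]
    have h3 : ∀ u, R.1 ((R⁻¹).1 u) = u := fun u => by
      rw [← mul_apply_eq_comp, Units.mul_inv, one_apply_eq_self]
    rw [h1, ← map_add]
    exact ⟨fun h => by rw [← h, h2], fun h => by rw [h, h3]⟩
  -- The term `z y` is moved to the right-hand side of the equation with parameter zero.
  have hshift : ∀ v : C(Icc (0 : ℝ) 1, ℂ), EqOn y (extend v) (Icc 0 1) →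
      (IsForcedSolution b₀ b₁ z c (extend f) y ↔
        IsForcedSolution b₀ b₁ 0 c (extend (f + z • v)) y) := by
    intro v hyv
    have key : ∀ᵐ x ∂volume.restrict (Ioo (0 : ℝ) 1),
        z * y x + extend f x = 0 * y x + extend (f + z • v) x := by
      filter_upwards [ae_restrict_mem measurableSet_Ioo] with x hx
      rw [hyv (Ioo_subset_Icc_self hx), extend_add, extend_smul, Pi.add_apply, Pi.smul_apply,
        smul_eq_mul]
      ring
    refine ⟨fun h => ⟨h.ac2, ?_, h.init, h.init_der⟩, fun h => ⟨h.ac2, ?_, h.init, h.init_der⟩⟩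
    · filter_upwards [h.eq, key] with x h1 h2
      rw [h1, h2]
    · filter_upwards [h.eq, key] with x h1 h2
      rw [h1, h2]
  have hmain : ∀ v : C(Icc (0 : ℝ) 1, ℂ), EqOn y (extend v) (Icc 0 1) →
      (IsForcedSolution b₀ b₁ z c (extend f) y ↔ v = G c + K (f + z • v)) := by
    intro v hyv
    rw [hshift v hyv, isForcedSolution_zero_iff hb₀ hw hq c (continuous_extend _), ← hGK,
      ← eqOn_extend_iff]
    have h1 := eqOn_extend_forcedSolutionMap hw hq c (f + z • v)
    exact ⟨fun h => hyv.symm.trans (h.symm.trans h1.symm), fun h => h1.symm.trans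
      (h.symm.trans hyv.symm)⟩
  refine ⟨fun h => ?_, fun h => (hmain _ h).2 ((hv _).2 rfl)⟩
  obtain ⟨v, hyv⟩ := exists_eqOn_extend h.ac2.differentiableOn.continuousOn
  have := (hv v).1 ((hmain v hyv).1 h)
  rw [this] at hyv
  exact hyv

end Diffusion

/-! ### Power series of operators applied to inverse polynomials -/

namespace PowerSeries

variable {k : Type*} [Field k]

theorem inverseSMul_X_apply (c : ℕ →₀ k) (j : ℕ) : inverseSMul X c j = c (j + 1) := by
  simpa [add_comm] using inverseSMul_X_pow_apply c 1 j

theorem inverseSMul_mul (f g : k⟦X⟧) (c : ℕ →₀ k) :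
    inverseSMul (f * g) c = inverseSMul f (inverseSMul g c) := by
  simp only [← inverseAction_apply, map_mul, Module.End.mul_apply]

theorem inverseSMul_comm (f g : k⟦X⟧) (c : ℕ →₀ k) :
    inverseSMul f (inverseSMul g c) = inverseSMul g (inverseSMul f c) := by
  rw [← inverseSMul_mul, mul_comm, inverseSMul_mul]

theorem eq_zero_iff_inverseSMul_X (c : ℕ →₀ k) : c = 0 ↔ c 0 = 0 ∧ inverseSMul X c = 0 := by
  refine ⟨fun h => by simp [h], fun h => Finsupp.ext fun j => ?_⟩
  cases j with
  | zero => exact h.1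
  | succ j => rw [← inverseSMul_X_apply, h.2]; rfl

theorem exists_inverseSMul_X_eq (a : k) (c : ℕ →₀ k) :
    ∃ b : ℕ →₀ k, b 0 = a ∧ inverseSMul X b = c := by
  refine ⟨Finsupp.single 0 a + c.mapDomain Nat.succ, ?_, Finsupp.ext fun j => ?_⟩
  · simp [Finsupp.mapDomain_of_notMem_range]
  · rw [inverseSMul_X_apply]
    simp [Finsupp.mapDomain_apply Nat.succ_injective]

theorem exists_inverseSMul_X_pow_eq_zero (c : ℕ →₀ k) :
    ∃ n, ∀ m ≥ n, inverseSMul (X ^ m) c = 0 := by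
  refine ⟨c.support.sup id + 1, fun m hm => Finsupp.ext fun j => ?_⟩
  rw [inverseSMul_X_pow_apply]
  by_contra h
  have := Finset.le_sup (f := id) (Finsupp.mem_support_iff.2 h)
  simp only [id] at this
  omega

/-- The shift of vectors of finitely supported sequences. -/
def shiftVec (c : Fin 2 → ℕ →₀ k) : Fin 2 → ℕ →₀ k := fun j => inverseSMul X (c j)

theorem matrixAction_shiftVec (A : Matrix (Fin 2) (Fin 2) k⟦X⟧) (c : Fin 2 → ℕ →₀ k) (i : Fin 2) :
    matrixAction A (shiftVec c) i = inverseSMul X (matrixAction A c i) := by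
  simp only [matrixAction_apply, map_sum, shiftVec, inverseSMul_comm X]

theorem exists_shiftVec_eq (a : Fin 2 → k) (c : Fin 2 → ℕ →₀ k) :
    ∃ b : Fin 2 → ℕ →₀ k, (fun j => b j 0) = a ∧ shiftVec b = c := by
  choose b hb using fun j => exists_inverseSMul_X_eq (a j) (c j)
  exact ⟨b, funext fun j => (hb j).1, funext fun j => (hb j).2⟩

theorem exists_forall_inverseSMul_X_pow_eq_zero (c : Fin 2 → ℕ →₀ k) :
    ∃ n, ∀ j, inverseSMul (X ^ n) (c j) = 0 := by
  choose n hn using fun j => exists_inverseSMul_X_pow_eq_zero (c j)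
  exact ⟨Finset.univ.sup n, fun j => hn j _ (Finset.le_sup (Finset.mem_univ j))⟩

section Expansion

variable {V : Type*} [AddCommGroup V] [Module k V] (K : Module.End k V)
  (Y : (Fin 2 → k) →ₗ[k] V)

/-- The vector `∑ m, K ^ m (Y c_m)`. -/
def expansion : (Fin 2 → ℕ →₀ k) →ₗ[k] V :=
  ∑ j, (Finsupp.linearCombination k fun m => (K ^ m) (Y (Pi.single j 1))).comp (LinearMap.proj j)

theorem expansion_apply (c : Fin 2 → ℕ →₀ k) : expansion K Y c =
    ∑ j, Finsupp.linearCombination k (fun m => (K ^ m) (Y (Pi.single j 1))) (c j) := by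
  simp [expansion]

theorem linearCombination_pow_apply (v : V) (c : ℕ →₀ k) :
    Finsupp.linearCombination k (fun m => (K ^ m) v) c =
      c 0 • v + K (Finsupp.linearCombination k (fun m => (K ^ m) v) (inverseSMul X c)) := by
  induction c using Finsupp.induction_linear with
  | zero => simp
  | add c d hc hd =>
    simp only [map_add, Finsupp.add_apply, add_smul]
    nth_rw 1 [hc, hd]
    abel
  | single m a =>
    cases m with
    | zero =>
      have : inverseSMul X (Finsupp.single 0 a) = 0 := Finsupp.ext fun j => by
        simp [inverseSMul_X_apply]
      simp [this]
    | succ m =>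
      have : inverseSMul X (Finsupp.single (m + 1) a) = Finsupp.single m a :=
        Finsupp.ext fun j => by simp [inverseSMul_X_apply, Finsupp.single_apply]
      simp [this, pow_succ']

theorem expansion_eq (c : Fin 2 → ℕ →₀ k) :
    expansion K Y c = Y (fun j => c j 0) + K (expansion K Y (shiftVec c)) := by
  rw [LinearMap.pi_apply_eq_sum_univ Y, expansion_apply, expansion_apply, map_sum,
    ← Finset.sum_add_distrib]
  refine Finset.sum_congr rfl fun j _ => ?_
  rw [linearCombination_pow_apply, shiftVec]
  congr 3
  exact funext fun i => by simp [Pi.single_apply, eq_comm]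

/-- If `Y a + K v` determines `a` and `v`, then `∑ m, K ^ m (Y c_m)` determines `c`. -/
theorem expansion_injective (h : ∀ a v, Y a + K v = 0 → a = 0 ∧ v = 0) :
    Function.Injective (expansion K Y) := by
  have key : ∀ (n : ℕ) (c : Fin 2 → ℕ →₀ k), (∀ j, inverseSMul (X ^ n) (c j) = 0) →
      expansion K Y c = 0 → c = 0 := by
    intro n
    induction n with
    | zero =>
      intro c hc _
      refine funext fun j => Finsupp.ext fun i => ?_
      simpa only [inverseSMul_X_pow_apply, zero_add] using! DFunLike.congr_fun (hc j) i
    | succ n ih =>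
      intro c hc h0
      rw [expansion_eq] at h0
      obtain ⟨h1, h2⟩ := h _ _ h0
      have h3 := ih (shiftVec c) (fun j => by
        rw [shiftVec, ← inverseSMul_mul, ← pow_succ, hc j]) h2
      exact funext fun j => (eq_zero_iff_inverseSMul_X _).2 ⟨congrFun h1 j, congrFun h3 j⟩
  refine (injective_iff_map_eq_zero _).2 fun c hc => ?_
  obtain ⟨n, hn⟩ := exists_forall_inverseSMul_X_pow_eq_zero c
  exact key n c hn hc

variable (B : Fin 2 → V →ₗ[k] k)

/-- The matrix of power series `B (1 - X K)⁻¹ Y`. -/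
def transferMatrix : Matrix (Fin 2) (Fin 2) k⟦X⟧ :=
  Matrix.of fun i j => mk fun m => B i ((K ^ m) (Y (Pi.single j 1)))

theorem matrixAction_transferMatrix_apply_zero (c : Fin 2 → ℕ →₀ k) (i : Fin 2) :
    matrixAction (transferMatrix K Y B) c i 0 = B i (expansion K Y c) := by
  rw [matrixAction_apply, Finsupp.finsetSum_apply, expansion_apply, map_sum]
  refine Finset.sum_congr rfl fun j _ => ?_
  rw [inverseSMul_apply_zero, pairing, Finsupp.apply_linearCombination]
  congr 2
  funext m
  simp [transferMatrix]

theorem matrixAction_transferMatrix_eq_zero_iff (c : Fin 2 → ℕ →₀ k) :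
    matrixAction (transferMatrix K Y B) c = 0 ↔ (∀ i, B i (expansion K Y c) = 0) ∧
      matrixAction (transferMatrix K Y B) (shiftVec c) = 0 := by
  simp only [funext_iff, ← forall_and, ← matrixAction_transferMatrix_apply_zero,
    matrixAction_shiftVec]
  exact forall_congr' fun i => eq_zero_iff_inverseSMul_X _

end Expansion

end PowerSeries

namespace Diffusion

/-! ### Generalized eigenvectors as graph chains -/

theorem mem_kerPow_shift_succ {E : Type*} [AddCommGroup E] [Module ℂ E] (T : E →ₗ.[ℂ] E) (z : ℂ)
    (n : ℕ) (x : E) : x ∈ kerPow (shift T z) (n + 1) ↔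
      ∃ y ∈ kerPow (shift T z) n, (x, y + z • x) ∈ T.graph := by
  have happ : ∀ u : T.domain, (shift T z).toFun u = T u - z • (u : E) := fun u => by
    have : (shift T z).toFun u = -(z • (u : E)) + T u := rfl
    rw [this, neg_add_eq_sub]
  constructor
  · rintro ⟨u, hu, rfl⟩
    refine ⟨_, hu, (LinearPMap.mem_graph_iff T).2 ⟨u, rfl, ?_⟩⟩
    exact (sub_eq_iff_eq_add.1 (happ u).symm)
  · rintro ⟨y, hy, h⟩
    obtain ⟨u, rfl, hu⟩ := (LinearPMap.mem_graph_iff T).1 h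
    have hu' : (shift T z).toFun u = y := (happ u).trans (sub_eq_iff_eq_add.2 hu)
    exact ⟨u, (congrArg (· ∈ kerPow (shift T z) n) hu').mpr hy, rfl⟩

variable {b₀ : ℝ → ℝ} {b₁ : ℝ → ℂ}

/-! ### Continuous functions in the weighted space -/

theorem ac_weightMeasure (hb₀ : ∀ᵐ x ∂volume.restrict (Ioo (0 : ℝ) 1), b₀ x < 0)
    (hw : IntegrableOn (fun x => -1 / b₀ x) (Ioo 0 1)) :
    volume.restrict (Ioo (0 : ℝ) 1) ≪ weightMeasure b₀ := by
  refine withDensity_absolutelyContinuous' hw.aemeasurable.ennreal_ofReal ?_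
  filter_upwards [hb₀] with x hx
  simp only [ne_eq, ENNReal.ofReal_eq_zero, not_le]
  exact div_pos_of_neg_of_neg (by norm_num) hx

theorem memLp_extend (hw : IntegrableOn (fun x => -1 / b₀ x) (Ioo 0 1))
    (v : C(Icc (0 : ℝ) 1, ℂ)) : MemLp (extend v) 2 (weightMeasure b₀) := by
  have : IsFiniteMeasure (weightMeasure b₀) := isFiniteMeasure_withDensity_ofReal hw.2
  exact MemLp.of_bound (continuous_extend v).aestronglyMeasurable ‖v‖
    (.of_forall fun x => v.norm_coe_le_norm _)

/-- The class in `L²_w` of a continuous function on `[0,1]`. -/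
def toWeightedL2 (hw : IntegrableOn (fun x => -1 / b₀ x) (Ioo 0 1)) :
    C(Icc (0 : ℝ) 1, ℂ) →ₗ[ℂ] WeightedL2 b₀ where
  toFun v := (memLp_extend hw v).toLp
  map_add' u v := MemLp.toLp_add (memLp_extend hw u) (memLp_extend hw v)
  map_smul' z v := MemLp.toLp_const_smul z (memLp_extend hw v)

theorem coeFn_toWeightedL2 (hw : IntegrableOn (fun x => -1 / b₀ x) (Ioo 0 1))
    (v : C(Icc (0 : ℝ) 1, ℂ)) : toWeightedL2 hw v =ᵐ[weightMeasure b₀] extend v :=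
  (memLp_extend hw v).coeFn_toLp

theorem eq_zero_of_extend_ae_eq_zero {v : C(Icc (0 : ℝ) 1, ℂ)}
    (h : extend v =ᵐ[volume.restrict (Ioo (0 : ℝ) 1)] 0) : v = 0 := by
  have h1 : EqOn (extend v) 0 (Ioo 0 1) := Measure.eqOn_open_of_ae_eq h isOpen_Ioo
    (continuous_extend v).continuousOn continuousOn_const
  have h2 := h1.closure (continuous_extend v) continuous_const
  rw [closure_Ioo zero_ne_one] at h2
  exact eqOn_extend_iff.1 h2

theorem toWeightedL2_injective (hb₀ : ∀ᵐ x ∂volume.restrict (Ioo (0 : ℝ) 1), b₀ x < 0)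
    (hw : IntegrableOn (fun x => -1 / b₀ x) (Ioo 0 1)) :
    Function.Injective (toWeightedL2 hw) := by
  refine (injective_iff_map_eq_zero _).2 fun v hv => eq_zero_of_extend_ae_eq_zero ?_
  refine (ac_weightMeasure hb₀ hw).ae_eq ((coeFn_toWeightedL2 hw v).symm.trans ?_)
  rw [hv]
  exact Lp.coeFn_zero ..

theorem toWeightedL2_eq_iff (hw : IntegrableOn (fun x => -1 / b₀ x) (Ioo 0 1)) {f : WeightedL2 b₀}
    {v : C(Icc (0 : ℝ) 1, ℂ)} {y : ℝ → ℂ} (hy : EqOn y (extend v) (Icc 0 1)) :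
    f = toWeightedL2 hw v ↔ f =ᵐ[weightMeasure b₀] y := by
  have h : toWeightedL2 hw v =ᵐ[weightMeasure b₀] y := by
    refine (coeFn_toWeightedL2 hw v).trans ((weightMeasure_ac b₀).ae_eq ?_)
    filter_upwards [ae_restrict_mem measurableSet_Ioo] with x hx
    exact (hy (Ioo_subset_Icc_self hx)).symm
  exact ⟨fun hf => hf ▸ h, fun hf => Lp.ext (hf.trans h.symm)⟩

/-! ### The boundary conditions -/

/-- The boundary functional `v ↦ ∫ v dν - v s`. -/
def boundaryForm (ν : Measure (Ioo (0 : ℝ) 1)) [IsProbabilityMeasure ν] (s : Icc (0 : ℝ) 1) :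
    C(Icc (0 : ℝ) 1, ℂ) →L[ℂ] ℂ :=
  LinearMap.mkContinuous
    { toFun := fun v => (∫ x, extend v x ∂ν) - extend v s
      map_add' := fun u v => by
        simp only [extend_add, Pi.add_apply]
        rw [integral_add (integrable_of_continuousOn (continuous_extend u).continuousOn ν)
          (integrable_of_continuousOn (continuous_extend v).continuousOn ν)]
        ring
      map_smul' := fun z v => by
        simp only [extend_smul, Pi.smul_apply, integral_smul, smul_sub, RingHom.id_apply] }
    2 fun v => by
      have h : ∀ x, ‖extend v x‖ ≤ ‖v‖ := fun x => v.norm_coe_le_norm _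
      have h1 : ‖∫ x, extend v x ∂ν‖ ≤ ‖v‖ := by
        simpa using norm_integral_le_of_norm_le_const (μ := ν) (.of_forall fun x => h x)
      refine (norm_sub_le _ _).trans ?_
      linarith [h s]

theorem boundaryForm_apply (ν : Measure (Ioo (0 : ℝ) 1)) [IsProbabilityMeasure ν]
    (s : Icc (0 : ℝ) 1) {v : C(Icc (0 : ℝ) 1, ℂ)} {y : ℝ → ℂ}
    (hy : EqOn y (extend v) (Icc 0 1)) : boundaryForm ν s v = (∫ x, y x ∂ν) - y s := by
  rw [hy s.2, integral_congr_ae (g := fun x : Ioo (0 : ℝ) 1 => extend v x)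
    (.of_forall fun x => hy (Ioo_subset_Icc_self x.2))]
  rfl

variable (ν₀ ν₁ : Measure (Ioo (0 : ℝ) 1)) [IsProbabilityMeasure ν₀] [IsProbabilityMeasure ν₁]

/-- The two boundary functionals of the operator `L`. -/
def boundaryForms : Fin 2 → C(Icc (0 : ℝ) 1, ℂ) →L[ℂ] ℂ :=
  ![boundaryForm ν₀ ⟨0, by simp⟩, boundaryForm ν₁ ⟨1, by simp⟩]

theorem boundaryForms_eq_zero_iff {v : C(Icc (0 : ℝ) 1, ℂ)} {y : ℝ → ℂ}
    (hy : EqOn y (extend v) (Icc 0 1)) :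
    (∀ i, boundaryForms ν₀ ν₁ i v = 0) ↔ y 0 = ∫ x, y x ∂ν₀ ∧ y 1 = ∫ x, y x ∂ν₁ := by
  simp only [Fin.forall_fin_two, boundaryForms, Matrix.cons_val_zero, Matrix.cons_val_one,
    boundaryForm_apply _ _ hy, sub_eq_zero]
  rw [eq_comm, @eq_comm _ (∫ x, y x ∂ν₁)]

/-! ### The generalized eigenspace -/

section Eigenspace

variable {z : ℂ} {K : C(Icc (0 : ℝ) 1, ℂ) →L[ℂ] C(Icc (0 : ℝ) 1, ℂ)}
  {Y : (Fin 2 → ℂ) →ₗ[ℂ] C(Icc (0 : ℝ) 1, ℂ)}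

/-- The part of the graph of `L` over which `L - z` takes the class of the continuous function `u`:
elements of the domain are solutions of the equation with right-hand side `u`, hence continuous. -/
theorem mem_graph_iff (hb₀ : ∀ᵐ x ∂volume.restrict (Ioo (0 : ℝ) 1), b₀ x < 0)
    (hw : IntegrableOn (fun x => -1 / b₀ x) (Ioo 0 1)) (hKY : IsSolutionPair b₀ b₁ z K Y)
    (f : WeightedL2 b₀) (u : C(Icc (0 : ℝ) 1, ℂ)) :
    (f, toWeightedL2 hw u + z • f) ∈ graph b₀ b₁ ν₀ ν₁ ↔
      ∃ c, f = toWeightedL2 hw (Y c + K u) ∧ ∀ i, boundaryForms ν₀ ν₁ i (Y c + K u) = 0 := by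
  have hg : ⇑(toWeightedL2 hw u + z • f) =ᵐ[weightMeasure b₀] extend u + z • ⇑f :=
    (Lp.coeFn_add _ _).trans ((coeFn_toWeightedL2 hw u).add (Lp.coeFn_smul z f))
  constructor
  · rintro ⟨y, hy⟩
    have h : IsForcedSolution b₀ b₁ z ![y 0, der y 0] (extend u) y := by
      refine ⟨hy.ac2, (ac_weightMeasure hb₀ hw).ae_le ?_, rfl, rfl⟩
      filter_upwards [hg, hy.fst, hy.snd] with x h1 h2 h3
      rw [← h3, h1, ← h2, add_comm]
      rfl
    have hv := (hKY _ _ _).1 h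
    exact ⟨_, (toWeightedL2_eq_iff hw hv).2 hy.fst,
      (boundaryForms_eq_zero_iff ν₀ ν₁ hv).2 ⟨hy.left, hy.right⟩⟩
  · rintro ⟨c, hf, hB⟩
    have hv := eqOn_refl (extend (Y c + K u)) (Icc 0 1)
    have h := (hKY c u _).2 hv
    have hfst := (toWeightedL2_eq_iff hw hv).1 hf
    obtain ⟨h0, h1⟩ := (boundaryForms_eq_zero_iff ν₀ ν₁ hv).1 hB
    refine ⟨_, h.ac2, hfst, ?_, h0, h1⟩
    filter_upwards [hg, hfst, (weightMeasure_ac b₀).ae_le h.eq] with x h1 h2 h3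
    rw [h3, h1, ← h2, add_comm]
    rfl

/-- A solution determines its initial data and the right-hand side of its equation. -/
theorem IsSolutionPair.eq_zero (hKY : IsSolutionPair b₀ b₁ z K Y) (c : Fin 2 → ℂ)
    (u : C(Icc (0 : ℝ) 1, ℂ)) (h : Y c + K u = 0) : c = 0 ∧ u = 0 := by
  have h1 : IsForcedSolution b₀ b₁ z c (extend u) 0 := (hKY c u 0).2 (by
    rw [h]
    exact eqOn_refl _ _)
  refine ⟨funext fun i => ?_, eq_zero_of_extend_ae_eq_zero ?_⟩
  · fin_cases i
    · exact h1.init.symm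
    · exact h1.init_der.symm.trans (by rw [der_zero]; rfl)
  · filter_upwards [h1.eq] with x hx
    simpa [diffExpr, der_zero] using hx.symm

open PowerSeries

/-- Solutions of `(l - z)ⁿ y = 0` are the sums `∑ Kᵐ Y c_m` over `m < n`, and `l - z` acts on them
as the shift of `c`, so that the boundary conditions for all `(l - z)ᵐ y` together become one
equation over the ring of power series. -/
theorem mem_kerPow_iff (hb₀ : ∀ᵐ x ∂volume.restrict (Ioo (0 : ℝ) 1), b₀ x < 0)
    (hw : IntegrableOn (fun x => -1 / b₀ x) (Ioo 0 1)) (hKY : IsSolutionPair b₀ b₁ z K Y)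
    (n : ℕ) (f : WeightedL2 b₀) : f ∈ kerPow (shift (operator b₀ b₁ ν₀ ν₁) z) n ↔
      ∃ c, (∀ j, inverseSMul (X ^ n) (c j) = 0) ∧
        matrixAction (transferMatrix K.toLinearMap Y fun i => boundaryForms ν₀ ν₁ i) c = 0 ∧
        toWeightedL2 hw (expansion K.toLinearMap Y c) = f := by
  induction n generalizing f with
  | zero =>
    have h0 : ∀ c : ℕ →₀ ℂ, inverseSMul 1 c = 0 ↔ c = 0 := fun c => by
      rw [← inverseAction_apply, map_one, Module.End.one_apply]
    simp only [kerPow, Submodule.mem_bot, pow_zero, h0]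
    constructor
    · rintro rfl
      exact ⟨0, by simp⟩
    · rintro ⟨c, hc, -, rfl⟩
      rw [show c = 0 from funext hc, map_zero, map_zero]
  | succ n ih =>
    rw [mem_kerPow_shift_succ, operator_graph b₀ b₁ ν₀ ν₁ hb₀ hw]
    constructor
    · rintro ⟨g, hg, hfg⟩
      obtain ⟨c', hn, hker, rfl⟩ := (ih g).1 hg
      obtain ⟨a, rfl, hB⟩ := (mem_graph_iff ν₀ ν₁ hb₀ hw hKY f _).1 hfg
      obtain ⟨c, rfl, rfl⟩ := exists_shiftVec_eq a c'
      have he := expansion_eq K.toLinearMap Y c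
      refine ⟨c, fun j => ?_, (matrixAction_transferMatrix_eq_zero_iff _ _ _ _).2 ⟨?_, hker⟩, ?_⟩
      · rw [pow_succ, inverseSMul_mul]
        exact hn j
      · rw [he]
        exact hB
      · rw [he]
        rfl
    · rintro ⟨c, hn, hker, rfl⟩
      have he := expansion_eq K.toLinearMap Y c
      obtain ⟨hB, hker'⟩ := (matrixAction_transferMatrix_eq_zero_iff _ _ _ _).1 hker
      refine ⟨_, (ih _).2 ⟨shiftVec c, fun j => ?_, hker', rfl⟩,
        (mem_graph_iff ν₀ ν₁ hb₀ hw hKY _ _).2 ⟨fun j => c j 0, ?_, ?_⟩⟩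
      · rw [shiftVec, ← inverseSMul_mul, ← pow_succ, hn j]
      · rw [he]
        rfl
      · rw [he] at hB
        exact hB

theorem generalizedEigenspace_eq (hb₀ : ∀ᵐ x ∂volume.restrict (Ioo (0 : ℝ) 1), b₀ x < 0)
    (hw : IntegrableOn (fun x => -1 / b₀ x) (Ioo 0 1)) (hKY : IsSolutionPair b₀ b₁ z K Y) :
    generalizedEigenspace (operator b₀ b₁ ν₀ ν₁) z =
      (LinearMap.ker (matrixAction (transferMatrix K.toLinearMap Y
        fun i => boundaryForms ν₀ ν₁ i))).map
        ((toWeightedL2 hw).comp (expansion K.toLinearMap Y)) := by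
  refine le_antisymm (iSup_le fun n f hf => ?_) ?_
  · obtain ⟨c, -, hc, rfl⟩ := (mem_kerPow_iff ν₀ ν₁ hb₀ hw hKY n f).1 hf
    exact ⟨c, hc, rfl⟩
  · rintro _ ⟨c, hc, rfl⟩
    obtain ⟨n, hn⟩ := exists_forall_inverseSMul_X_pow_eq_zero c
    exact le_iSup (fun n => kerPow (shift (operator b₀ b₁ ν₀ ν₁) z) n) n
      ((mem_kerPow_iff ν₀ ν₁ hb₀ hw hKY n _).2 ⟨c, hn, hc, rfl⟩)

theorem algebraicMultiplicity_eq (hb₀ : ∀ᵐ x ∂volume.restrict (Ioo (0 : ℝ) 1), b₀ x < 0)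
    (hw : IntegrableOn (fun x => -1 / b₀ x) (Ioo 0 1)) (hKY : IsSolutionPair b₀ b₁ z K Y) :
    algebraicMultiplicity (operator b₀ b₁ ν₀ ν₁) z =
      (transferMatrix K.toLinearMap Y fun i => boundaryForms ν₀ ν₁ i).det.order := by
  have hinj : Function.Injective ((toWeightedL2 hw).comp (expansion K.toLinearMap Y)) :=
    (toWeightedL2_injective hb₀ hw).comp (expansion_injective _ _ hKY.eq_zero)
  rw [algebraicMultiplicity, generalizedEigenspace_eq ν₀ ν₁ hb₀ hw hKY,
    ← (Submodule.equivMapOfInjective _ hinj _).rank_eq, toENat_rank_ker_matrixAction]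

end Eigenspace

/-! ### The characteristic function -/

theorem isSolution_iff {z h k : ℂ} {y : ℝ → ℂ} :
    IsSolution b₀ b₁ z h k y ↔ IsForcedSolution b₀ b₁ z ![h, k] 0 y :=
  ⟨fun H => ⟨H.ac2, by simpa using H.eq, H.init, H.init_der⟩,
    fun H => ⟨H.ac2, by simpa using H.eq, H.init, H.init_der⟩⟩

theorem isSolution_solution (hb₀ : ∀ᵐ x ∂volume.restrict (Ioo (0 : ℝ) 1), b₀ x < 0)
    (hw : IntegrableOn (fun x => -1 / b₀ x) (Ioo 0 1))
    (hq : IntegrableOn (fun x => b₁ x / (b₀ x : ℂ)) (Ioo 0 1)) (z h k : ℂ) :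
    IsSolution b₀ b₁ z h k (solution b₀ b₁ z h k) := by
  obtain ⟨K, Y, hKY⟩ := exists_isSolutionPair hb₀ hw hq z
  exact Classical.epsilon_spec (p := IsSolution b₀ b₁ z h k)
    ⟨_, isSolution_iff.2 ((hKY ![h, k] 0 _).2 (eqOn_refl _ _))⟩

/-- The solution at the parameter `z + t` solves the equation at `z` with right-hand side `t y`. -/
theorem IsSolutionPair.exists_eq_add_smul {z t h k : ℂ} {y : ℝ → ℂ}
    {K : C(Icc (0 : ℝ) 1, ℂ) →L[ℂ] C(Icc (0 : ℝ) 1, ℂ)}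
    {Y : (Fin 2 → ℂ) →ₗ[ℂ] C(Icc (0 : ℝ) 1, ℂ)} (hKY : IsSolutionPair b₀ b₁ z K Y)
    (hy : IsSolution b₀ b₁ (z + t) h k y) :
    ∃ v, EqOn y (extend v) (Icc 0 1) ∧ v = Y ![h, k] + t • K v := by
  obtain ⟨v, hv⟩ := exists_eqOn_extend hy.ac2.differentiableOn.continuousOn
  have H : IsForcedSolution b₀ b₁ z ![h, k] (extend (t • v)) y := by
    refine ⟨hy.ac2, ?_, hy.init, hy.init_der⟩
    filter_upwards [hy.eq, ae_restrict_mem measurableSet_Ioo] with x h1 h2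
    rw [h1, extend_smul, Pi.smul_apply, ← hv (Ioo_subset_Icc_self h2), smul_eq_mul]
    ring
  refine ⟨v, hv, ?_⟩
  rw [← map_smul]
  exact eqOn_extend_iff.1 (hv.symm.trans ((hKY _ _ _).1 H))

theorem hasSum_pow_smul_of_eq_add_smul {V : Type*} [NormedAddCommGroup V] [NormedSpace ℂ V]
    [CompleteSpace V] {K : V →L[ℂ] V} {u v : V} {t : ℂ} (ht : ‖t‖ * ‖K‖ < 1) (h : v = u + t • K v) :
    HasSum (fun n : ℕ => t ^ n • (K ^ n) u) v := by
  have ht : ‖t • K‖ < 1 := (norm_smul_le t K).trans_lt ht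
  have h1 := (summable_geometric_of_norm_lt_one (x := t • K) ht).hasSum
  have h2 := geom_series_mul_neg (t • K) ht
  have h3 : (1 - t • K) v = u := by
    rw [sub_apply, one_apply_eq_self, smul_apply]
    nth_rw 1 [h]
    simp
  have h4 := (ContinuousLinearMap.apply ℂ V u).hasSum h1
  have h5 : (ContinuousLinearMap.apply ℂ V u) (∑' n : ℕ, (t • K) ^ n) = v := by
    rw [ContinuousLinearMap.apply_apply, ← h3, ← mul_apply_eq_comp, h2, one_apply_eq_self]
  rw [h5] at h4
  refine h4.congr_fun fun n => ?_
  rw [ContinuousLinearMap.apply_apply, smul_pow, smul_apply]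

open PowerSeries

theorem IsSolutionPair.isTaylorSeries {z : ℂ}
    {K : C(Icc (0 : ℝ) 1, ℂ) →L[ℂ] C(Icc (0 : ℝ) 1, ℂ)}
    {Y : (Fin 2 → ℂ) →ₗ[ℂ] C(Icc (0 : ℝ) 1, ℂ)} (hKY : IsSolutionPair b₀ b₁ z K Y)
    (h k : ℂ) {y : ℂ → ℝ → ℂ} (hy : ∀ z, IsSolution b₀ b₁ z h k (y z))
    (ν : Measure (Ioo (0 : ℝ) 1)) [IsProbabilityMeasure ν] (s : Icc (0 : ℝ) 1) :
    IsTaylorSeries (mk fun n => boundaryForm ν s ((K.toLinearMap ^ n) (Y ![h, k])))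
      (fun z => (∫ x, y z x ∂ν) - y z s) z := by
  have hsmall : ∀ᶠ t in 𝓝 (0 : ℂ), ‖t‖ * ‖K‖ < 1 := by
    have h0 : ContinuousAt (fun t : ℂ => ‖t‖ * ‖K‖) 0 := by fun_prop
    have h1 : ‖(0 : ℂ)‖ * ‖K‖ < 1 := by simp
    exact h0.eventually (gt_mem_nhds h1)
  filter_upwards [hsmall] with t ht
  obtain ⟨v, hv, hv'⟩ := hKY.exists_eq_add_smul (hy (z + t))
  have h1 := (boundaryForm ν s).hasSum (hasSum_pow_smul_of_eq_add_smul ht hv')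
  have h2 : ∀ n, boundaryForm ν s (t ^ n • (K ^ n) (Y ![h, k])) =
      coeff n (mk fun n => boundaryForm ν s ((K.toLinearMap ^ n) (Y ![h, k]))) * t ^ n := by
    intro n
    rw [coeff_mk, map_smul, smul_eq_mul, mul_comm, ← ContinuousLinearMap.toLinearMap_pow]
    rfl
  simp only [h2] at h1
  exact ⟨h1.summable.norm, by rw [h1.tsum_eq, boundaryForm_apply ν s hv]⟩

theorem isTaylorSeries_charFun (hb₀ : ∀ᵐ x ∂volume.restrict (Ioo (0 : ℝ) 1), b₀ x < 0)
    (hw : IntegrableOn (fun x => -1 / b₀ x) (Ioo 0 1))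
    (hq : IntegrableOn (fun x => b₁ x / (b₀ x : ℂ)) (Ioo 0 1)) {z : ℂ}
    {K : C(Icc (0 : ℝ) 1, ℂ) →L[ℂ] C(Icc (0 : ℝ) 1, ℂ)}
    {Y : (Fin 2 → ℂ) →ₗ[ℂ] C(Icc (0 : ℝ) 1, ℂ)} (hKY : IsSolutionPair b₀ b₁ z K Y) :
    IsTaylorSeries (transferMatrix K.toLinearMap Y fun i => boundaryForms ν₀ ν₁ i).det
      (charFun b₀ b₁ ν₀ ν₁) z := by
  have h1 : ∀ z, IsSolution b₀ b₁ z 1 0 (y₁ b₀ b₁ z) := fun z =>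
    isSolution_solution hb₀ hw hq z 1 0
  have h2 : ∀ z, IsSolution b₀ b₁ z 0 1 (y₂ b₀ b₁ z) := fun z =>
    isSolution_solution hb₀ hw hq z 0 1
  have e0 : (Pi.single 0 1 : Fin 2 → ℂ) = ![1, 0] := by
    ext i
    fin_cases i <;> simp
  have e1 : (Pi.single 1 1 : Fin 2 → ℂ) = ![0, 1] := by
    ext i
    fin_cases i <;> simp
  have hF := ((hKY.isTaylorSeries 1 0 h1 ν₀ ⟨0, by simp⟩).mul
    (hKY.isTaylorSeries 0 1 h2 ν₁ ⟨1, by simp⟩)).sub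
    ((hKY.isTaylorSeries 0 1 h2 ν₀ ⟨0, by simp⟩).mul
      (hKY.isTaylorSeries 1 0 h1 ν₁ ⟨1, by simp⟩))
  rw [Matrix.det_fin_two]
  convert hF using 1
  · simp [transferMatrix, boundaryForms, e0, e1]
  · funext z
    simp [charFun, Matrix.det_fin_two_of, (h1 z).init, (h2 z).init]

end Diffusion

end

theorem theorem1 (b₀ : ℝ → ℝ) (b₁ : ℝ → ℂ)
    (hb₀ : ∀ᵐ x ∂volume.restrict (Ioo (0 : ℝ) 1), b₀ x < 0)
    (hw : IntegrableOn (fun x => -1 / b₀ x) (Ioo 0 1))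
    (hq : IntegrableOn (fun x => b₁ x / (b₀ x : ℂ)) (Ioo 0 1))
    (ν₀ ν₁ : Measure (Ioo (0 : ℝ) 1)) [IsProbabilityMeasure ν₀] [IsProbabilityMeasure ν₁] :
    Differentiable ℂ (Diffusion.charFun b₀ b₁ ν₀ ν₁) ∧
    ∀ z₀ : ℂ, Diffusion.IsEigenvalue (Diffusion.operator b₀ b₁ ν₀ ν₁) z₀ →
      Diffusion.algebraicMultiplicity (Diffusion.operator b₀ b₁ ν₀ ν₁) z₀ =
        analyticOrderAt (Diffusion.charFun b₀ b₁ ν₀ ν₁) z₀ := by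
  refine ⟨fun z => ?_, fun z _ => ?_⟩
  · obtain ⟨K, Y, hKY⟩ := Diffusion.exists_isSolutionPair hb₀ hw hq z
    exact (Diffusion.isTaylorSeries_charFun ν₀ ν₁ hb₀ hw hq
      hKY).hasFPowerSeriesAt.analyticAt.differentiableAt
  · obtain ⟨K, Y, hKY⟩ := Diffusion.exists_isSolutionPair hb₀ hw hq z
    rw [Diffusion.algebraicMultiplicity_eq ν₀ ν₁ hb₀ hw hKY,
      (Diffusion.isTaylorSeries_charFun ν₀ ν₁ hb₀ hw hq hKY).analyticOrderAt_eq]
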